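/- Let $d,m\in\mathbb N$ and let $V=(v_{ij}):\mathbb R^d\to\mathbb R^{m\times m}$ have entries $v_{ij}=v_{ji}\in L^1_{\rm loc}(\mathbb R^d)$ with $v_{ij}\le 0$ for $i\ne j$ and $\langle V(x)\xi,\xi\rangle\ge 0$ for all $\xi\in\mathbb R^m$ and almost every $x\in\mathbb R^d$. For a potential $W$ with these properties set $$a_W(f,g)=\int_{\mathbb R^d}\Big(\sum_{i=1}^m\langle\nabla f_i,\nabla g_i\rangle+\langle Wf,g\rangle\Big)dx ,$$ for $f,g$ in the maximal domain $\{f\in L^2(\mathbb R^d,\mathbb R^m):\nabla f\in L^2,\ W^{1/2}f\in L^2\}$ (weak derivatives). Let $\mathcal H$ be the operator on $L^2(\mathbb R^d,\mathbb R^m)$ associated with $a_V$ on its maximal domain $\mathcal V$, that is, $u\in D(\mathcal H)$ and $\mathcal Hu=v$ if and only if $u\in\mathcal V$, $v\in L^2$ and $a_V(u,\varphi)=\langle v,\varphi\rangle_{L^2}$ for all $\varphi\in\mathcal V$. For $\varepsilon>0$ and $M\in\mathbb N$ let $V_\varepsilon=V+\varepsilon$, and let $V_{\varepsilon,M}$ be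 the matrix with diagonal entries $v_{ii}+\varepsilon$ and off-diagonal entries $\max\{v_{ij},-M\}$ ($i\neq j$). Let $\mathcal V_\varepsilon$ and $\mathcal V_{\varepsilon,M}$ be the closures of $C_c^\infty(\mathbb R^d,\mathbb R^m)$ with respect to the norms $\|f\|_{\mathcal V_\varepsilon}=a_{V_\varepsilon}(f,f)^{1/2}$ and $a_{V_{\varepsilon,M}}(f,f)^{1/2}$, respectively, and let $\mathcal H_{\varepsilon,M}$ be the operator on $L^2(\mathbb R^d,\mathbb R^m)$ associated, in the same way, with $a_{V_{\varepsilon,M}}$ on $\mathcal V_{\varepsilon,M}$. Then $\mathcal H_{\varepsilon,M}$ (for every $M$) and $\mathcal H+\varepsilon$ are bijective from their domains onto $L^2(\mathbb R^d,\mathbb R^m)$, and for every compactly supported $f\in L^2(\mathbb R^d,\mathbb R^m)$ the following hold. 1. $\mathcal H_{\varepsilon,M}^{-1}f$ and $(\mathcal H+\varepsilon)^{-1}f$ belong to $\mathcal V_\varepsilon$, and $\|\mathcal H_{\varepsilon,M}^{-1}f-(\mathcal H+\varepsilon)^{-1}f\|_{\mathcal V_\varepsilon}\to 0$ as $M\to\infty$.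 2. If $f$ is componentwise nonnegative (almost everywhere), then $\mathcal H_{\varepsilon,M}^{-1}f$ (for every $M$) and $(\mathcal H+\varepsilon)^{-1}f$ are componentwise nonnegative, and $\mathcal H_{\varepsilon,M_1}^{-1}f\le\mathcal H_{\varepsilon,M_2}^{-1}f$ componentwise, almost everywhere, whenever $M_1\le M_2$. -/

import Mathlib

open MeasureTheory Filter Topology
open scoped ContDiff

namespace VSchrodinger

/-- `ℝⁿ` with the Euclidean norm. -/
abbrev RSp (n : ℕ) := EuclideanSpace ℝ (Fin n)

/-- The real Hilbert space `L²(ℝᵈ, ℝᵐ)`. -/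
noncomputable abbrev L2 (d m : ℕ) := Lp (RSp m) 2 (volume : Measure (RSp d))

/-- `⟨Aξ, η⟩` for a real `m × m` matrix `A` and `ξ, η ∈ ℝᵐ`. -/
def matPair {m : ℕ} (A : Matrix (Fin m) (Fin m) ℝ) (ξ η : RSp m) : ℝ :=
  ∑ i, ∑ j, A i j * ξ j * η i

/-- Matrix potentials on `ℝᵈ`: locally integrable entries, almost everywhere symmetric and
nonnegative definite, with nonpositive off-diagonal entries. -/
structure Potential (d m : ℕ) where
  toFun : RSp d → Matrix (Fin m) (Fin m) ℝ
  locInt : ∀ i j, LocallyIntegrable (fun x => toFun x i j) volume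
  symm : ∀ᵐ x, ∀ i j, toFun x i j = toFun x j i
  offDiag : ∀ᵐ x, ∀ i j, i ≠ j → toFun x i j ≤ 0
  nonneg : ∀ᵐ x, ∀ ξ : RSp m, 0 ≤ matPair (toFun x) ξ ξ

/-! ### Algebra of `matPair` -/

theorem matPair_add_left {m : ℕ} (A : Matrix (Fin m) (Fin m) ℝ) (ξ ξ' η : RSp m) :
    matPair A (ξ + ξ') η = matPair A ξ η + matPair A ξ' η := by
  simp only [matPair, ← Finset.sum_add_distrib]
  refine Finset.sum_congr rfl fun i _ => Finset.sum_congr rfl fun j _ => ?_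
  simp only [PiLp.add_apply]; ring

theorem matPair_smul_left {m : ℕ} (A : Matrix (Fin m) (Fin m) ℝ) (c : ℝ) (ξ η : RSp m) :
    matPair A (c • ξ) η = c * matPair A ξ η := by
  simp only [matPair, Finset.mul_sum]
  refine Finset.sum_congr rfl fun i _ => Finset.sum_congr rfl fun j _ => ?_
  simp only [PiLp.smul_apply, smul_eq_mul]; ring

theorem matPair_comm {m : ℕ} {A : Matrix (Fin m) (Fin m) ℝ} (hA : ∀ i j, A i j = A j i)
    (ξ η : RSp m) : matPair A ξ η = matPair A η ξ := by
  simp only [matPair]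
  rw [Finset.sum_comm]
  refine Finset.sum_congr rfl fun i _ => Finset.sum_congr rfl fun j _ => ?_
  rw [hA j i]; ring

theorem abs_matPair_le {m : ℕ} {A : Matrix (Fin m) (Fin m) ℝ} (hA : ∀ i j, A i j = A j i)
    (hp : ∀ ξ : RSp m, 0 ≤ matPair A ξ ξ) (ξ η : RSp m) :
    |matPair A ξ η| ≤ matPair A ξ ξ + matPair A η η := by
  have key : ∀ c : ℝ, matPair A (ξ + c • η) (ξ + c • η)
      = matPair A ξ ξ + 2 * c * matPair A ξ η + c ^ 2 * matPair A η η := by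
    intro c
    rw [matPair_add_left, matPair_smul_left, matPair_comm hA ξ, matPair_comm hA η (ξ + c • η),
      matPair_add_left, matPair_add_left, matPair_smul_left, matPair_smul_left,
      matPair_comm hA η ξ]
    ring
  have h1 := hp (ξ + (1 : ℝ) • η)
  have h2 := hp (ξ + (-1 : ℝ) • η)
  rw [key] at h1 h2
  have h3 := hp ξ
  have h4 := hp η
  rw [abs_le]
  constructor <;> nlinarith

theorem matPair_add_smul_one {m : ℕ} (A : Matrix (Fin m) (Fin m) ℝ) (c : ℝ) (ξ : RSp m) :
    matPair (A + c • (1 : Matrix (Fin m) (Fin m) ℝ)) ξ ξ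
      = matPair A ξ ξ + c * ∑ i, ξ i ^ 2 := by
  simp only [matPair, Finset.mul_sum, ← Finset.sum_add_distrib]
  refine Finset.sum_congr rfl fun i _ => ?_
  simp only [Matrix.add_apply, Matrix.smul_apply, smul_eq_mul, add_mul, Finset.sum_add_distrib,
    Matrix.one_apply]
  congr 1
  simp [pow_two, mul_assoc]

/-! ### The potentials `V + ε` and `V_{ε,M}` -/

/-- The truncated matrix `A_{ε,M}`: diagonal entries `a_{ii} + ε`, off-diagonal entries
`max a_{ij} (-M)`. -/
def truncMatrix {m : ℕ} (A : Matrix (Fin m) (Fin m) ℝ) (ε : ℝ) (M : ℕ) :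
    Matrix (Fin m) (Fin m) ℝ :=
  fun i j => if i = j then A i j + ε else max (A i j) (-(M : ℝ))

theorem truncMatrix_nonneg {m : ℕ} {A : Matrix (Fin m) (Fin m) ℝ} {ε : ℝ} (hε : 0 < ε) (M : ℕ)
    (ho : ∀ i j, i ≠ j → A i j ≤ 0) (hp : ∀ ξ : RSp m, 0 ≤ matPair A ξ ξ) (ξ : RSp m) :
    0 ≤ matPair (truncMatrix A ε M) ξ ξ := by
  refine (hp (WithLp.toLp 2 fun i => |ξ i|)).trans ?_
  refine Finset.sum_le_sum fun i _ => Finset.sum_le_sum fun j _ => ?_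
  by_cases hij : i = j
  · subst hij
    simp only [truncMatrix, if_true]
    have : |ξ i| * |ξ i| = ξ i * ξ i := abs_mul_abs_self _
    have h := mul_nonneg hε.le (mul_self_nonneg (ξ i))
    rw [mul_assoc, mul_assoc, this]
    linarith
  · simp only [truncMatrix, hij, if_false]
    have h0 := ho i j hij
    have h1 : max (A i j) (-(M : ℝ)) ≤ 0 := max_le h0 (by simp)
    have h2 : A i j ≤ max (A i j) (-(M : ℝ)) := le_max_left _ _
    have h3 : ξ j * ξ i ≤ |ξ j| * |ξ i| := by rw [← abs_mul]; exact le_abs_self _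
    have h4 : 0 ≤ |ξ j| * |ξ i| := by positivity
    rw [mul_assoc, mul_assoc]
    nlinarith

namespace Potential

variable {d m : ℕ}

/-- The potential `V_ε = V + ε`. -/
def shift (V : Potential d m) (ε : ℝ) (hε : 0 < ε) : Potential d m where
  toFun x := V.toFun x + ε • (1 : Matrix (Fin m) (Fin m) ℝ)
  locInt i j :=
    (V.locInt i j).add (locallyIntegrable_const ((ε • (1 : Matrix (Fin m) (Fin m) ℝ)) i j))
  symm := by
    filter_upwards [V.symm] with x hx i j
    simp only [Matrix.add_apply, Matrix.smul_apply, hx i j, Matrix.one_apply, eq_comm]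
  offDiag := by
    filter_upwards [V.offDiag] with x hx i j hij
    simpa [Matrix.one_apply, hij] using hx i j hij
  nonneg := by
    filter_upwards [V.nonneg] with x hx ξ
    rw [matPair_add_smul_one]
    have := hx ξ
    positivity

/-- The truncated potential `V_{ε,M}`. -/
def trunc (V : Potential d m) (ε : ℝ) (hε : 0 < ε) (M : ℕ) : Potential d m where
  toFun x := truncMatrix (V.toFun x) ε M
  locInt i j := by
    by_cases hij : i = j
    · simp only [truncMatrix, hij, if_true]
      exact (V.locInt j j).add (locallyIntegrable_const ε)
    · simp only [truncMatrix, hij, if_false]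
      refine (V.locInt i j).mono ?_ (Eventually.of_forall fun x => ?_)
      · exact (V.locInt i j).aestronglyMeasurable.sup aestronglyMeasurable_const
      · have hM : (0 : ℝ) ≤ M := Nat.cast_nonneg M
        simp only [Real.norm_eq_abs]
        rcases le_total (V.toFun x i j) (-(M : ℝ)) with h | h
        · rw [max_eq_right h, abs_of_nonpos (by linarith), abs_of_nonpos (by linarith)]
          linarith
        · rw [max_eq_left h]
  symm := by
    filter_upwards [V.symm] with x hx i j
    by_cases hij : i = j
    · subst hij; rfl
    · simp only [truncMatrix, hij, Ne.symm hij, if_false, hx i j]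
  offDiag := by
    filter_upwards [V.offDiag] with x hx i j hij
    simp only [truncMatrix, hij, if_false]
    exact max_le (hx i j hij) (by simp)
  nonneg := by
    filter_upwards [V.offDiag, V.nonneg] with x ho hp ξ
    exact truncMatrix_nonneg hε M ho hp ξ

end Potential

/-! ### Weak derivatives -/

/-- `g` is the `k`-th weak (distributional) partial derivative of `f`. -/
def IsWeakPartial {d m : ℕ} (k : Fin d) (f g : L2 d m) : Prop :=
  ∀ φ : RSp d → ℝ, ContDiff ℝ ∞ φ → HasCompactSupport φ →
    ∫ x, (fderiv ℝ φ x (EuclideanSpace.single k 1)) • f x = -∫ x, φ x • g x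

open Classical in
/-- The `k`-th weak partial derivative of `f` if it exists in `L²` (and `0` otherwise). -/
noncomputable def weakPartial {d m : ℕ} (k : Fin d) (f : L2 d m) : L2 d m :=
  if h : ∃ g, IsWeakPartial k f g then h.choose else 0

theorem locallyIntegrable_L2 {d m : ℕ} (f : L2 d m) :
    LocallyIntegrable (fun x => f x) (volume : Measure (RSp d)) :=
  (Lp.memLp f).locallyIntegrable (by norm_num)

theorem integrable_smul_L2 {d m : ℕ} (f : L2 d m) {φ : RSp d → ℝ} (hφ : Continuous φ)
    (hc : HasCompactSupport φ) : Integrable (fun x => φ x • f x) (volume : Measure (RSp d)) :=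
  (locallyIntegrable_L2 f).integrable_smul_left_of_hasCompactSupport hφ hc

theorem integrable_fderiv_smul_L2 {d m : ℕ} (f : L2 d m) {φ : RSp d → ℝ} (hφ : ContDiff ℝ ∞ φ)
    (hc : HasCompactSupport φ) (v : RSp d) :
    Integrable (fun x => (fderiv ℝ φ x v) • f x) (volume : Measure (RSp d)) := by
  refine integrable_smul_L2 f ?_ (hc.fderiv_apply (𝕜 := ℝ) v)
  exact (hφ.continuous_fderiv (by simp)).clm_apply continuous_const

theorem IsWeakPartial.unique {d m : ℕ} {k : Fin d} {f g g' : L2 d m}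
    (h : IsWeakPartial k f g) (h' : IsWeakPartial k f g') : g = g' := by
  refine Lp.ext (ae_eq_of_integral_contDiff_smul_eq (locallyIntegrable_L2 g)
    (locallyIntegrable_L2 g') fun φ hφ hc => ?_)
  have := (h φ hφ hc).symm.trans (h' φ hφ hc)
  exact neg_injective this

theorem IsWeakPartial.add {d m : ℕ} {k : Fin d} {f f' g g' : L2 d m}
    (h : IsWeakPartial k f g) (h' : IsWeakPartial k f' g') :
    IsWeakPartial k (f + f') (g + g') := by
  intro φ hφ hc
  have e1 : ∀ {u : RSp d → ℝ}, (fun x => u x • (f + f' : L2 d m) x) =ᵐ[volume]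
      fun x => u x • f x + u x • f' x := by
    intro u
    filter_upwards [Lp.coeFn_add f f'] with x hx
    rw [hx, Pi.add_apply, smul_add]
  have e2 : (fun x => φ x • (g + g' : L2 d m) x) =ᵐ[volume]
      fun x => φ x • g x + φ x • g' x := by
    filter_upwards [Lp.coeFn_add g g'] with x hx
    rw [hx, Pi.add_apply, smul_add]
  rw [integral_congr_ae e1, integral_congr_ae e2,
    integral_add (integrable_fderiv_smul_L2 f hφ hc _) (integrable_fderiv_smul_L2 f' hφ hc _),
    integral_add (integrable_smul_L2 g hφ.continuous hc)
      (integrable_smul_L2 g' hφ.continuous hc), h φ hφ hc, h' φ hφ hc]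
  abel

theorem IsWeakPartial.smul {d m : ℕ} {k : Fin d} {f g : L2 d m} (c : ℝ)
    (h : IsWeakPartial k f g) : IsWeakPartial k (c • f) (c • g) := by
  intro φ hφ hc
  have e1 : ∀ {u : RSp d → ℝ} {f : L2 d m}, (fun x => u x • (c • f : L2 d m) x) =ᵐ[volume]
      fun x => c • (u x • f x) := by
    intro u f
    filter_upwards [Lp.coeFn_smul c f] with x hx
    rw [hx, Pi.smul_apply, smul_comm]
  rw [integral_congr_ae e1, integral_congr_ae e1, integral_smul, integral_smul, h φ hφ hc,
    smul_neg]

theorem IsWeakPartial.weakPartial_eq {d m : ℕ} {k : Fin d} {f g : L2 d m}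
    (h : IsWeakPartial k f g) : weakPartial k f = g := by
  have hex : ∃ g, IsWeakPartial k f g := ⟨g, h⟩
  rw [weakPartial, dif_pos hex]
  exact hex.choose_spec.unique h

/-! ### The form -/

/-- The integrand `∑ᵢ ⟨∇fᵢ, ∇gᵢ⟩ + ⟨V f, g⟩`. -/
noncomputable def formDensity {d m : ℕ} (V : Potential d m) (f g : L2 d m) (x : RSp d) : ℝ :=
  (∑ i : Fin m, ∑ k : Fin d, weakPartial k f x i * weakPartial k g x i)
    + matPair (V.toFun x) (f x) (g x)

/-- The form `a_V(f, g) = ∫ (∑ᵢ ⟨∇fᵢ, ∇gᵢ⟩ + ⟨V f, g⟩) dx`. -/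
noncomputable def form {d m : ℕ} (V : Potential d m) (f g : L2 d m) : ℝ :=
  ∫ x, formDensity V f g x

/-- The (semi)norm `a_V(f, f)^{1/2}` induced by the form. -/
noncomputable def formNorm {d m : ℕ} (V : Potential d m) (f : L2 d m) : ℝ :=
  Real.sqrt (form V f f)

theorem aestronglyMeasurable_matPair {d m : ℕ} (V : Potential d m) (f g : L2 d m) :
    AEStronglyMeasurable (fun x => matPair (V.toFun x) (f x) (g x)) volume := by
  have hc : ∀ (f : L2 d m) (i : Fin m), AEStronglyMeasurable (fun x => f x i) volume := by
    intro f i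
    exact (EuclideanSpace.proj (𝕜 := ℝ) i).continuous.comp_aestronglyMeasurable
      (Lp.aestronglyMeasurable f)
  unfold matPair
  refine Finset.aestronglyMeasurable_fun_sum _ fun i _ =>
    Finset.aestronglyMeasurable_fun_sum _ fun j _ => ?_
  exact (((V.locInt i j).aestronglyMeasurable).mul (hc f j)).mul (hc g i)

theorem integrable_matPair {d m : ℕ} (V : Potential d m) {f g : L2 d m}
    (hf : Integrable (fun x => matPair (V.toFun x) (f x) (f x)) volume)
    (hg : Integrable (fun x => matPair (V.toFun x) (g x) (g x)) volume) :
    Integrable (fun x => matPair (V.toFun x) (f x) (g x)) volume := by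
  refine (hf.add hg).mono' (aestronglyMeasurable_matPair V f g) ?_
  filter_upwards [V.symm, V.nonneg] with x hs hp
  exact abs_matPair_le hs hp _ _

theorem integrable_grad {d m : ℕ} (f g : L2 d m) :
    Integrable (fun x => ∑ i : Fin m, ∑ k : Fin d, weakPartial k f x i * weakPartial k g x i)
      volume := by
  refine integrable_finsetSum _ fun i _ => integrable_finsetSum _ fun k _ => ?_
  have hc : ∀ f : L2 d m, MemLp (fun x => f x i) 2 volume := fun f =>
    (EuclideanSpace.proj (𝕜 := ℝ) i).comp_memLp' (Lp.memLp f)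
  exact (hc _).integrable_mul (hc _)

/-- The maximal form domain: all `f ∈ L²` with weak gradient in `L²` and `V^{1/2} f ∈ L²`. Since
`‖V^{1/2} f‖² = ⟨V f, f⟩`, the last condition says that `⟨V f, f⟩` is integrable. -/
noncomputable def formDomain {d m : ℕ} (V : Potential d m) : Submodule ℝ (L2 d m) where
  carrier := {f | (∀ k, ∃ g, IsWeakPartial k f g) ∧
    Integrable (fun x => matPair (V.toFun x) (f x) (f x)) volume}
  add_mem' := by
    rintro f g ⟨hf, hf'⟩ ⟨hg, hg'⟩
    refine ⟨fun k => ?_, ?_⟩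
    · obtain ⟨u, hu⟩ := hf k
      obtain ⟨v, hv⟩ := hg k
      exact ⟨u + v, hu.add hv⟩
    · refine ((hf'.add hg').add ((integrable_matPair V hf' hg').const_mul 2)).congr ?_
      filter_upwards [V.symm, Lp.coeFn_add f g] with x hs hx
      rw [hx]
      simp only [Pi.add_apply]
      rw [matPair_add_left, matPair_comm hs (f x) (f x + g x), matPair_comm hs (g x) (f x + g x),
        matPair_add_left, matPair_add_left, matPair_comm hs (g x) (f x)]
      ring
  zero_mem' := by
    refine ⟨fun k => ⟨0, fun φ _ _ => ?_⟩, ?_⟩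
    · have e : ∀ u : RSp d → ℝ, (fun x => u x • (0 : L2 d m) x) =ᵐ[volume] fun _ => 0 := by
        intro u
        filter_upwards [Lp.coeFn_zero (RSp m) 2 (volume : Measure (RSp d))] with x hx
        rw [hx]; simp
      rw [integral_congr_ae (e _), integral_congr_ae (e _)]; simp
    · refine (integrable_zero (RSp d) ℝ volume).congr ?_
      filter_upwards [Lp.coeFn_zero (RSp m) 2 (volume : Measure (RSp d))] with x hx
      rw [hx]; simp [matPair]
  smul_mem' := by
    rintro c f ⟨hf, hf'⟩
    refine ⟨fun k => ?_, ?_⟩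
    · obtain ⟨u, hu⟩ := hf k
      exact ⟨c • u, hu.smul c⟩
    · refine (hf'.const_mul (c ^ 2)).congr ?_
      filter_upwards [V.symm, Lp.coeFn_smul c f] with x hs hx
      rw [hx]
      simp only [Pi.smul_apply]
      rw [matPair_smul_left, matPair_comm hs (f x) (c • f x), matPair_smul_left]
      ring

theorem integrable_formDensity {d m : ℕ} (V : Potential d m) {f g : L2 d m}
    (hf : f ∈ formDomain V) (hg : g ∈ formDomain V) :
    Integrable (formDensity V f g) volume :=
  (integrable_grad f g).add (integrable_matPair V hf.2 hg.2)

theorem weakPartial_add {d m : ℕ} {V : Potential d m} (k : Fin d) {f g : L2 d m}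
    (hf : f ∈ formDomain V) (hg : g ∈ formDomain V) :
    weakPartial k (f + g) = weakPartial k f + weakPartial k g := by
  obtain ⟨u, hu⟩ := hf.1 k
  obtain ⟨v, hv⟩ := hg.1 k
  rw [(hu.add hv).weakPartial_eq, hu.weakPartial_eq, hv.weakPartial_eq]

theorem weakPartial_smul {d m : ℕ} {V : Potential d m} (k : Fin d) (c : ℝ) {f : L2 d m}
    (hf : f ∈ formDomain V) : weakPartial k (c • f) = c • weakPartial k f := by
  obtain ⟨u, hu⟩ := hf.1 k
  rw [(hu.smul c).weakPartial_eq, hu.weakPartial_eq]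

theorem form_add_left {d m : ℕ} (V : Potential d m) {f g h : L2 d m}
    (hf : f ∈ formDomain V) (hg : g ∈ formDomain V) (hh : h ∈ formDomain V) :
    form V (f + g) h = form V f h + form V g h := by
  rw [form, form, form, ← integral_add (integrable_formDensity V hf hh)
    (integrable_formDensity V hg hh)]
  refine integral_congr_ae ?_
  have hw : ∀ᵐ x, ∀ k : Fin d, weakPartial k (f + g) x = weakPartial k f x + weakPartial k g x := by
    rw [ae_all_iff]
    intro k
    rw [weakPartial_add k hf hg]
    exact Lp.coeFn_add _ _
  filter_upwards [Lp.coeFn_add f g, hw] with x hx hw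
  simp only [formDensity, hw, hx, Pi.add_apply, matPair_add_left, PiLp.add_apply, add_mul,
    Finset.sum_add_distrib]
  ring

theorem form_smul_left {d m : ℕ} (V : Potential d m) (c : ℝ) {f h : L2 d m}
    (hf : f ∈ formDomain V) : form V (c • f) h = c * form V f h := by
  rw [form, form, ← integral_const_mul]
  refine integral_congr_ae ?_
  have hw : ∀ᵐ x, ∀ k : Fin d, weakPartial k (c • f) x = c • weakPartial k f x := by
    rw [ae_all_iff]
    intro k
    rw [weakPartial_smul k c hf]
    exact Lp.coeFn_smul _ _
  filter_upwards [Lp.coeFn_smul c f, hw] with x hx hw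
  simp only [formDensity, hw, hx, Pi.smul_apply, matPair_smul_left, PiLp.smul_apply, smul_eq_mul,
    mul_assoc, mul_add, Finset.mul_sum]

theorem form_comm {d m : ℕ} (V : Potential d m) (f g : L2 d m) : form V f g = form V g f := by
  refine integral_congr_ae ?_
  filter_upwards [V.symm] with x hs
  simp only [formDensity, matPair_comm hs (f x) (g x)]
  congr 1
  exact Finset.sum_congr rfl fun i _ => Finset.sum_congr rfl fun k _ => mul_comm _ _

theorem form_nonneg {d m : ℕ} (V : Potential d m) (f : L2 d m) : 0 ≤ form V f f := by
  refine integral_nonneg_of_ae ?_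
  filter_upwards [V.nonneg] with x hp
  have h1 := hp (f x)
  have h2 : 0 ≤ ∑ i : Fin m, ∑ k : Fin d, weakPartial k f x i * weakPartial k f x i :=
    Finset.sum_nonneg fun i _ => Finset.sum_nonneg fun k _ => mul_self_nonneg _
  simp only [Pi.zero_apply, formDensity]
  linarith

theorem form_add_self_le {d m : ℕ} (V : Potential d m) {f g : L2 d m}
    (hf : f ∈ formDomain V) (hg : g ∈ formDomain V) :
    form V (f + g) (f + g) ≤ 2 * form V f f + 2 * form V g g := by
  have hn : (-1 : ℝ) • g ∈ formDomain V := (formDomain V).smul_mem _ hg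
  have e : ∀ {u}, u ∈ formDomain V → form V (f + u) (f + u)
      = form V f f + 2 * form V f u + form V u u := by
    intro u hu
    have hs := (formDomain V).add_mem hf hu
    rw [form_add_left V hf hu hs, form_comm V f, form_comm V u, form_add_left V hf hu hf,
      form_add_left V hf hu hu, form_comm V u f]
    ring
  have h1 := e hn
  have h2 := form_nonneg V (f + (-1 : ℝ) • g)
  rw [h1, form_comm V f ((-1 : ℝ) • g), form_smul_left V _ hg, form_smul_left V _ hg,
    form_comm V g ((-1 : ℝ) • g), form_smul_left V _ hg, form_comm V g f] at h2
  rw [e hg]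
  linarith

/-! ### Test functions and closures -/

/-- `φ` is (the class of) an element of `C_c^∞(ℝᵈ, ℝᵐ)`. -/
def IsTest {d m : ℕ} (φ : L2 d m) : Prop :=
  ∃ ψ : RSp d → RSp m, φ =ᵐ[volume] ψ ∧ HasCompactSupport ψ ∧ ContDiff ℝ ∞ ψ

theorem IsTest.add {d m : ℕ} {φ φ' : L2 d m} (h : IsTest φ) (h' : IsTest φ') :
    IsTest (φ + φ') := by
  obtain ⟨ψ, h1, h2, h3⟩ := h
  obtain ⟨ψ', h1', h2', h3'⟩ := h'
  refine ⟨ψ + ψ', ?_, h2.add h2', h3.add h3'⟩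
  exact (Lp.coeFn_add φ φ').trans (h1.add h1')

theorem IsTest.smul {d m : ℕ} {φ : L2 d m} (c : ℝ) (h : IsTest φ) : IsTest (c • φ) := by
  obtain ⟨ψ, h1, h2, h3⟩ := h
  refine ⟨c • ψ, ?_, h2.smul_left (f := fun _ => c), contDiff_const.smul h3⟩
  filter_upwards [Lp.coeFn_smul c φ, h1] with x hx h1
  rw [hx, Pi.smul_apply, Pi.smul_apply, h1]

theorem IsTest.zero {d m : ℕ} : IsTest (0 : L2 d m) :=
  ⟨0, Lp.coeFn_zero _ _ _, HasCompactSupport.zero, contDiff_const⟩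

theorem IsTest.mem_formDomain {d m : ℕ} {φ : L2 d m} (h : IsTest φ) (V : Potential d m) :
    φ ∈ formDomain V := by
  obtain ⟨ψ, hψ, hc, hs⟩ := h
  refine ⟨fun k => ?_, ?_⟩
  · set e : RSp d := EuclideanSpace.single k 1
    have hcd : Continuous fun x => fderiv ℝ ψ x e :=
      (hs.continuous_fderiv (by simp)).clm_apply continuous_const
    have hcs : HasCompactSupport fun x => fderiv ℝ ψ x e := hc.fderiv_apply (𝕜 := ℝ) e
    have hm : MemLp (fun x => fderiv ℝ ψ x e) 2 (volume : Measure (RSp d)) :=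
      hcd.memLp_of_hasCompactSupport hcs
    refine ⟨hm.toLp _, fun η hη hηc => ?_⟩
    have e1 : (fun x => fderiv ℝ η x e • φ x) =ᵐ[volume] fun x => fderiv ℝ η x e • ψ x := by
      filter_upwards [hψ] with x hx
      rw [hx]
    have e2 : (fun x => η x • (hm.toLp _ : L2 d m) x) =ᵐ[volume]
        fun x => η x • fderiv ℝ ψ x e := by
      filter_upwards [hm.coeFn_toLp] with x hx
      rw [hx]
    have hcη : Continuous fun x => fderiv ℝ η x e :=
      (hη.continuous_fderiv (by simp)).clm_apply continuous_const
    rw [integral_congr_ae e1, integral_congr_ae e2]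
    rw [integral_smul_fderiv_eq_neg_fderiv_smul_of_integrable, neg_neg]
    · exact (hcη.smul hs.continuous).integrable_of_hasCompactSupport hc.smul_left
    · exact (hη.continuous.smul hcd).integrable_of_hasCompactSupport hcs.smul_left
    · exact (hη.continuous.smul hs.continuous).integrable_of_hasCompactSupport hc.smul_left
    · exact fun x _ => hη.differentiable (by simp) x
    · exact fun x _ => hs.differentiable (by simp) x
  · have h1 : Integrable (fun x => matPair (V.toFun x) (ψ x) (ψ x)) volume := by
      unfold matPair
      refine integrable_finsetSum _ fun i _ => integrable_finsetSum _ fun j _ => ?_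
      have hci : ∀ i, Continuous fun x => ψ x i := fun i =>
        (EuclideanSpace.proj (𝕜 := ℝ) i).continuous.comp hs.continuous
      have hsi : HasCompactSupport fun x => ψ x j * ψ x i :=
        (hc.comp_left (g := fun v : RSp m => v j * v i) (by simp))
      have := (V.locInt i j).integrable_smul_left_of_hasCompactSupport
        ((hci j).mul (hci i)) hsi
      refine this.congr (Eventually.of_forall fun x => ?_)
      simp only [smul_eq_mul, Pi.mul_apply]; ring
    refine h1.congr ?_
    filter_upwards [hψ] with x hx
    rw [hx]

/-- The closure of `C_c^∞(ℝᵈ, ℝᵐ)` with respect to the norm induced by the form `a_V`. -/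
noncomputable def formClosure {d m : ℕ} (V : Potential d m) : Submodule ℝ (L2 d m) where
  carrier := {f | f ∈ formDomain V ∧ ∀ δ > 0, ∃ φ, IsTest φ ∧ formNorm V (f - φ) < δ}
  add_mem' := by
    rintro f g ⟨hf, hf'⟩ ⟨hg, hg'⟩
    refine ⟨(formDomain V).add_mem hf hg, fun δ hδ => ?_⟩
    obtain ⟨φ, hφ, h1⟩ := hf' (δ / 2) (by positivity)
    obtain ⟨ψ, hψ, h2⟩ := hg' (δ / 2) (by positivity)
    refine ⟨φ + ψ, hφ.add hψ, ?_⟩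
    unfold formNorm at *
    rw [Real.sqrt_lt' (by positivity)] at *
    have := form_add_self_le V ((formDomain V).sub_mem hf (hφ.mem_formDomain V))
      ((formDomain V).sub_mem hg (hψ.mem_formDomain V))
    rw [add_sub_add_comm]
    nlinarith
  zero_mem' := by
    refine ⟨(formDomain V).zero_mem, fun δ hδ => ⟨0, IsTest.zero, ?_⟩⟩
    have h := form_smul_left V 0 (h := (0 : L2 d m)) (formDomain V).zero_mem
    rw [zero_smul, zero_mul] at h
    simpa [formNorm, h] using hδ
  smul_mem' := by
    rintro c f ⟨hf, hf'⟩
    refine ⟨(formDomain V).smul_mem c hf, fun δ hδ => ?_⟩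
    obtain ⟨φ, hφ, h1⟩ := hf' (δ / (|c| + 1)) (by positivity)
    refine ⟨c • φ, hφ.smul c, ?_⟩
    have hd := (formDomain V).sub_mem hf (hφ.mem_formDomain V)
    rw [← smul_sub, formNorm, form_smul_left V c hd, form_comm, form_smul_left V c hd,
      ← mul_assoc, Real.sqrt_mul (mul_self_nonneg c), Real.sqrt_mul_self_eq_abs]
    have h0 : 0 ≤ formNorm V (f - φ) := Real.sqrt_nonneg _
    have h2 : (|c| + 1) * formNorm V (f - φ) < δ := by
      rwa [lt_div_iff₀ (by positivity), mul_comm] at h1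
    change |c| * formNorm V (f - φ) < δ
    linarith

theorem IsTest.mem_formClosure {d m : ℕ} {φ : L2 d m} (h : IsTest φ) (V : Potential d m) :
    φ ∈ formClosure V := by
  refine ⟨h.mem_formDomain V, fun δ hδ => ⟨φ, h, ?_⟩⟩
  obtain ⟨ψ, -, hψ⟩ := (formClosure V).zero_mem.2 δ hδ
  have h0 := form_smul_left V 0 (h := (0 : L2 d m)) (formDomain V).zero_mem
  rw [zero_smul, zero_mul] at h0
  simpa [formNorm, h0] using hδ

/-! ### Operators associated with forms -/

/-- The graph of the operator associated with the form `a_V` on the domain `D`: all `(u, v)` with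
`u ∈ D`, `v ∈ L²` and `a_V(u, φ) = ⟨v, φ⟩` for all `φ ∈ D`. -/
noncomputable def formGraph {d m : ℕ} (V : Potential d m) (D : Submodule ℝ (L2 d m))
    (hD : D ≤ formDomain V) : Submodule ℝ (L2 d m × L2 d m) where
  carrier := {p | p.1 ∈ D ∧ ∀ φ ∈ D, form V p.1 φ = inner ℝ p.2 φ}
  add_mem' := by
    rintro p q ⟨hp, hp'⟩ ⟨hq, hq'⟩
    refine ⟨D.add_mem hp hq, fun φ hφ => ?_⟩
    rw [Prod.fst_add, Prod.snd_add, form_add_left V (hD hp) (hD hq) (hD hφ), hp' φ hφ, hq' φ hφ,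
      inner_add_left]
  zero_mem' := by
    refine ⟨D.zero_mem, fun φ _ => ?_⟩
    have h0 := form_smul_left V 0 (h := φ) (formDomain V).zero_mem
    rw [zero_smul, zero_mul] at h0
    rw [Prod.fst_zero, Prod.snd_zero, h0, inner_zero_left]
  smul_mem' := by
    rintro c p ⟨hp, hp'⟩
    refine ⟨D.smul_mem c hp, fun φ hφ => ?_⟩
    rw [Prod.smul_fst, Prod.smul_snd, form_smul_left V c (hD hp), hp' φ hφ, real_inner_smul_left]

/-- The unbounded operator on `L²(ℝᵈ, ℝᵐ)` associated with the form `a_V` on the domain `D`: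
`u` is in its domain and is mapped to `v` if and only if `(u, v)` is in `formGraph V D hD`. -/
noncomputable def formOperator {d m : ℕ} (V : Potential d m) (D : Submodule ℝ (L2 d m))
    (hD : D ≤ formDomain V) : L2 d m →ₗ.[ℝ] L2 d m :=
  (formGraph V D hD).toLinearPMap

/-- The associated operator is well defined as soon as `D` contains the test functions. -/
theorem formOperator_graph {d m : ℕ} (V : Potential d m) (D : Submodule ℝ (L2 d m))
    (hD : D ≤ formDomain V) (hT : ∀ φ, IsTest φ → φ ∈ D) :
    (formOperator V D hD).graph = formGraph V D hD := by
  refine Submodule.toLinearPMap_graph_eq _ ?_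
  rintro ⟨u, v⟩ ⟨hu, hv⟩ (rfl : u = 0)
  have h0 : ∀ φ, form V (0 : L2 d m) φ = 0 := by
    intro φ
    have h0 := form_smul_left V 0 (h := φ) (formDomain V).zero_mem
    rwa [zero_smul, zero_mul] at h0
  have hd : Dense {φ : L2 d m | ∃ ψ : RSp d → RSp m,
      φ =ᵐ[volume] ψ ∧ HasCompactSupport ψ ∧ ContDiff ℝ ∞ ψ} :=
    Lp.dense_hasCompactSupport_contDiff (by simp)
  refine hd.eq_zero_of_inner_left ℝ ?_
  intro φ hφ
  have := hv φ (hT φ hφ)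
  rw [h0] at this
  exact this.symm

/-- The operator `𝓗` associated with the form `a` on
`𝓥 = {f ∈ L² : ∇f ∈ L², V^{1/2} f ∈ L²}`. -/
noncomputable def opH {d m : ℕ} (V : Potential d m) : L2 d m →ₗ.[ℝ] L2 d m :=
  formOperator V (formDomain V) le_rfl

/-- The operator `𝓗 + ε`, with the domain of `𝓗`. -/
noncomputable def opHShift {d m : ℕ} (V : Potential d m) (ε : ℝ) : L2 d m →ₗ.[ℝ] L2 d m :=
  (ε • (LinearMap.id : L2 d m →ₗ[ℝ] L2 d m)) +ᵥ opH V

/-- The operator `𝓗_{ε,M}` associated with the form `a_{ε,M}` of the potential `V_{ε,M}` on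
`𝓥_{ε,M}`, the closure of the test functions in the norm induced by `a_{ε,M}`. -/
noncomputable def opHTrunc {d m : ℕ} (V : Potential d m) (ε : ℝ) (hε : 0 < ε) (M : ℕ) :
    L2 d m →ₗ.[ℝ] L2 d m :=
  formOperator (V.trunc ε hε M) (formClosure (V.trunc ε hε M)) fun _ h => h.1

open Classical in
/-- `T⁻¹ f`, for `f` in the range of the injective operator `T` (and `0` if `f` is not in the
range). -/
noncomputable def invApply {d m : ℕ} (T : L2 d m →ₗ.[ℝ] L2 d m) (f : L2 d m) : L2 d m :=
  if h : f ∈ T.inverse.domain then T.inverse ⟨f, h⟩ else 0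

/-- `f` has compact support: it vanishes almost everywhere outside some compact set. -/
def CompactlySupported {d m : ℕ} (f : L2 d m) : Prop :=
  ∃ K : Set (RSp d), IsCompact K ∧ ∀ᵐ x, x ∉ K → f x = 0

/-- `f ≤ g` componentwise, almost everywhere. -/
def CompLE {d m : ℕ} (f g : L2 d m) : Prop :=
  ∀ᵐ x, ∀ i, f x i ≤ g x i

end VSchrodinger

namespace VSchrodinger

open scoped Convolution ENNReal NNReal

/-! Write `W` for either `V + ε` or `V_{ε,M}`, and call `u` a solution for `f` if `a_W(u, φ) = ⟨f,
φ⟩` on the maximal form domain of `W`.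

Density: test functions are dense in the maximal form domain of every potential
(`formClosure_eq_formDomain`). An element is first truncated in its values, then cut off in space,
then mollified. The first two operations multiply the vector `w(x)` by a scalar in `[0, 1]`, so the
potential energy is dominated by that of `w`; the mollifications of a bounded, compactly supported
function are dominated through local integrability of `W`. Hence `𝓥_{ε,M}` is a maximal domain, and
both inverses become statements about solutions.

Solvability: the form is bounded below by a multiple of the squared `L²` norm, and the form domain
is complete (closedness of weak derivatives, and Fatou for the potential), so the Riesz theorem
gives a unique solution for each `f` (`Coercive.exists_isSolution`).

Order: nonpositive off-diagonal entries give `a_W(u⁺, u⁺) ≤ a_W(u, u⁺)` (`form_posPart_le`). Testing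
with positive parts shows that `f ≥ 0` forces `u ≥ 0`, and that lowering the entries of `W` raises a
nonnegative solution when the form domains agree. They agree for all `V_{ε,M}`: each is described by
integrability of the `v_{ii} f_i²`.

Convergence: let `f ≥ 0` and `E_W(v) = a_W(v, v) - 2⟨f, v⟩`. If `u` solves for `W`, then `E_W(v) -
E_W(u) = a_W(v - u, v - u)`. With `u_M` and `w` the solutions for `V_{ε,M}` and `V + ε`,
nonnegativity of `u_M` and minimality give, for every test function `v`, `E_{V+ε}(u_M) ≤
E_{V_{ε,M}}(u_M) ≤ E_{V_{ε,M}}(v) → E_{V+ε}(v)`. By density `E_{V+ε}(v)` can be taken close to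
`E_{V+ε}(w)`, so `a_{V+ε}(u_M - w, u_M - w) → 0` without any compactness argument. A general `f` is
split into positive and negative parts. -/

/-! ### Mollification -/

/-- A sequence of smooth bump functions shrinking to the origin. -/
noncomputable def bump (d n : ℕ) : ContDiffBump (0 : RSp d) where
  rIn := 1 / (2 * ((n : ℝ) + 1))
  rOut := 1 / ((n : ℝ) + 1)
  rIn_pos := by positivity
  rIn_lt_rOut := by
    apply one_div_lt_one_div_of_lt (by positivity)
    have : (0 : ℝ) ≤ n := n.cast_nonneg
    linarith

/-- The mollifier: a normalized smooth bump function. -/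
noncomputable def mollifier (d n : ℕ) : RSp d → ℝ := (bump d n).normed volume

/-- The mollification of `g`. -/
noncomputable def mollify {d m : ℕ} (n : ℕ) (g : L2 d m) : RSp d → RSp m :=
  mollifier d n ⋆[ContinuousLinearMap.lsmul ℝ ℝ, volume] g

theorem mollifier_nonneg (d n : ℕ) (y : RSp d) : 0 ≤ mollifier d n y :=
  (bump d n).nonneg_normed y

theorem contDiff_mollifier (d n : ℕ) : ContDiff ℝ ∞ (mollifier d n) :=
  (bump d n).contDiff_normed

theorem hasCompactSupport_mollifier (d n : ℕ) : HasCompactSupport (mollifier d n) :=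
  (bump d n).hasCompactSupport_normed

theorem integral_mollifier (d n : ℕ) : ∫ y, mollifier d n y = 1 :=
  (bump d n).integral_normed

theorem integrable_mollifier (d n : ℕ) : Integrable (mollifier d n) :=
  (contDiff_mollifier d n).continuous.integrable_of_hasCompactSupport
    (hasCompactSupport_mollifier d n)

theorem mollifier_eq_zero {d n : ℕ} {y : RSp d} (hy : 1 / ((n : ℝ) + 1) ≤ ‖y‖) :
    mollifier d n y = 0 := by
  by_contra h
  have h1 : y ∈ Function.support (mollifier d n) := h
  rw [mollifier, (bump d n).support_normed_eq, mem_ball_zero_iff] at h1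
  exact absurd h1 (not_lt.2 hy)

theorem lintegral_mollifier (d n : ℕ) : ∫⁻ y, ENNReal.ofReal (mollifier d n y) = 1 := by
  rw [← ofReal_integral_eq_lintegral_ofReal (integrable_mollifier d n)
    (Eventually.of_forall (mollifier_nonneg d n)), integral_mollifier, ENNReal.ofReal_one]

theorem contDiff_mollify {d m : ℕ} (n : ℕ) (g : L2 d m) : ContDiff ℝ ∞ (mollify n g) :=
  (hasCompactSupport_mollifier d n).contDiff_convolution_left _ (contDiff_mollifier d n)
    (locallyIntegrable_L2 g)

theorem mollify_apply {d m : ℕ} (n : ℕ) (g : L2 d m) (x : RSp d) :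
    mollify n g x = ∫ y, mollifier d n y • g (x - y) := rfl

theorem mollify_apply_swap {d m : ℕ} (n : ℕ) (g : L2 d m) (x : RSp d) :
    mollify n g x = ∫ y, mollifier d n (x - y) • g y :=
  convolution_lsmul_swap

theorem integrable_mollify_integrand {d m : ℕ} (n : ℕ) (g : L2 d m) (x : RSp d) :
    Integrable fun y => mollifier d n y • g (x - y) :=
  (hasCompactSupport_mollifier d n).convolutionExists_left (ContinuousLinearMap.lsmul ℝ ℝ)
    (contDiff_mollifier d n).continuous (locallyIntegrable_L2 g) x

theorem mollify_ae_tendsto {d m : ℕ} (g : L2 d m) :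
    ∀ᵐ x, Tendsto (fun n => mollify n g x) atTop (𝓝 (g x)) := by
  refine ContDiffBump.ae_convolution_tendsto_right_of_locallyIntegrable (K := 2)
    (φ := bump d) tendsto_one_div_add_atTop_nhds_zero_nat (Eventually.of_forall fun n => ?_)
    (locallyIntegrable_L2 g)
  change 1 / ((n : ℝ) + 1) ≤ 2 * (1 / (2 * ((n : ℝ) + 1)))
  have : (n : ℝ) + 1 ≠ 0 := by positivity
  apply le_of_eq
  field_simp

/-- Jensen's inequality for the probability density `w`, obtained from Cauchy–Schwarz applied to
`w^{1/2}` and `w^{1/2} h`. -/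
theorem sq_lintegral_mul_le {α : Type*} [MeasurableSpace α] {μ : Measure α} {w h : α → ℝ≥0∞}
    (hw : Measurable w) (hh : Measurable h) (h1 : ∫⁻ y, w y ∂μ = 1) :
    (∫⁻ y, w y * h y ∂μ) ^ 2 ≤ ∫⁻ y, w y * h y ^ 2 ∂μ := by
  have hH := ENNReal.lintegral_mul_le_Lp_mul_Lq μ Real.HolderConjugate.two_two
    (f := fun y => w y ^ (1 / 2 : ℝ)) (g := fun y => w y ^ (1 / 2 : ℝ) * h y)
    (by fun_prop) (by fun_prop)
  have e1 : ∀ y, w y ^ (1 / 2 : ℝ) * w y ^ (1 / 2 : ℝ) = w y := fun y => by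
    rw [← ENNReal.rpow_add_of_nonneg _ _ (by norm_num) (by norm_num)]; norm_num
  have e2 : ∀ y, (w y ^ (1 / 2 : ℝ)) ^ (2 : ℝ) = w y := fun y => by
    rw [← ENNReal.rpow_mul]; norm_num
  simp only [Pi.mul_apply, ← mul_assoc, e1, e2, h1,
    ENNReal.mul_rpow_of_nonneg _ _ (zero_le_two : (0 : ℝ) ≤ 2), ENNReal.one_rpow, one_mul] at hH
  calc (∫⁻ y, w y * h y ∂μ) ^ 2 ≤ ((∫⁻ y, w y * h y ^ (2 : ℝ) ∂μ) ^ (1 / 2 : ℝ)) ^ 2 := by gcongr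
    _ = ∫⁻ y, w y * h y ^ 2 ∂μ := by
      rw [← ENNReal.rpow_natCast, ← ENNReal.rpow_mul]; norm_num

/-- The error is an average of translation differences, so Jensen and Tonelli reduce it to the
shifts in the support of the mollifier. A small `C` gives convergence in `L²`; a crude `C` gives
membership in `L²`. -/
theorem lintegral_mollify_sub_le {d m : ℕ} (n : ℕ) (g : L2 d m) {C : ℝ≥0∞}
    (hC : ∀ y : RSp d, ‖y‖ ≤ 1 / ((n : ℝ) + 1) → ∫⁻ x, ‖g (x - y) - g x‖ₑ ^ 2 ≤ C) :
    ∫⁻ x, ‖mollify n g x - g x‖ₑ ^ 2 ≤ C := by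
  have hg : Measurable g := (Lp.stronglyMeasurable g).measurable
  have hρ : Measurable fun y => ENNReal.ofReal (mollifier d n y) :=
    (contDiff_mollifier d n).continuous.measurable.ennreal_ofReal
  have hpt : ∀ x, ‖mollify n g x - g x‖ₑ ^ 2
      ≤ ∫⁻ y, ENNReal.ofReal (mollifier d n y) * ‖g (x - y) - g x‖ₑ ^ 2 := by
    intro x
    have e : mollify n g x - g x = ∫ y, mollifier d n y • (g (x - y) - g x) := by
      simp only [smul_sub]
      rw [integral_sub (integrable_mollify_integrand n g x)
        ((integrable_mollifier d n).smul_const _), integral_smul_const, integral_mollifier,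
        one_smul, mollify_apply]
    refine le_trans ?_ (sq_lintegral_mul_le hρ (by fun_prop) (lintegral_mollifier d n))
    gcongr
    rw [e]
    refine (enorm_integral_le_lintegral_enorm _).trans (le_of_eq ?_)
    refine lintegral_congr fun y => ?_
    rw [enorm_smul, Real.enorm_of_nonneg (mollifier_nonneg d n y)]
  calc ∫⁻ x, ‖mollify n g x - g x‖ₑ ^ 2
      ≤ ∫⁻ x, ∫⁻ y, ENNReal.ofReal (mollifier d n y) * ‖g (x - y) - g x‖ₑ ^ 2 :=
        lintegral_mono hpt
    _ = ∫⁻ y, ∫⁻ x, ENNReal.ofReal (mollifier d n y) * ‖g (x - y) - g x‖ₑ ^ 2 := by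
        refine lintegral_lintegral_swap (Measurable.aemeasurable ?_)
        simp only [Function.uncurry_def]
        exact (hρ.comp measurable_snd).mul
          (((hg.comp (measurable_fst.sub measurable_snd)).sub
            (hg.comp measurable_fst)).enorm.pow_const 2)
    _ ≤ ∫⁻ y, ENNReal.ofReal (mollifier d n y) * C := by
        refine lintegral_mono fun y => ?_
        dsimp only
        rw [lintegral_const_mul _ (by fun_prop)]
        rcases le_total ‖y‖ (1 / ((n : ℝ) + 1)) with h | h
        · gcongr
          exact hC y h
        · rw [mollifier_eq_zero h]; simp
    _ = C := by rw [lintegral_mul_const _ hρ, lintegral_mollifier, one_mul]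

theorem eLpNorm_two_sq {α E : Type*} [MeasurableSpace α] [NormedAddCommGroup E] {μ : Measure α}
    (f : α → E) : eLpNorm f 2 μ ^ 2 = ∫⁻ x, ‖f x‖ₑ ^ 2 ∂μ := by
  have := eLpNorm_nnreal_pow_eq_lintegral (μ := μ) (f := f) (p := 2) (by norm_num)
  simpa using this

/-- Continuity of translations in `L²`, an instance of the continuity of composition with
measure-preserving maps. -/
theorem tendsto_lintegral_translate_sub {d m : ℕ} (g : L2 d m) :
    Tendsto (fun y : RSp d => ∫⁻ x, ‖g (x - y) - g x‖ₑ ^ 2) (𝓝 0) (𝓝 0) := by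
  let S : C(RSp d × RSp d, RSp d) := ⟨fun p => p.2 - p.1, by fun_prop⟩
  have hτ : ∀ y, MeasurePreserving (S.curry y) (volume : Measure (RSp d)) volume :=
    fun y => measurePreserving_sub_right volume y
  have hT : Tendsto (fun y => Lp.compMeasurePreserving (S.curry y) (hτ y) g) (𝓝 0)
      (𝓝 (Lp.compMeasurePreserving (S.curry 0) (hτ 0) g)) :=
    Tendsto.compMeasurePreservingLp (f := fun _ => g) tendsto_const_nhds
      (S.curry.continuous.tendsto 0) hτ (hτ 0) (by simp)
  have h0 : Lp.compMeasurePreserving (S.curry 0) (hτ 0) g = g := by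
    refine Lp.ext ((Lp.coeFn_compMeasurePreserving g (hτ 0)).trans (Eventually.of_forall ?_))
    intro x
    simp [S]
  rw [h0, Lp.tendsto_Lp_iff_tendsto_eLpNorm'] at hT
  have h2 := (ENNReal.continuous_pow 2).tendsto 0 |>.comp hT
  rw [zero_pow two_ne_zero] at h2
  refine h2.congr fun y => ?_
  simp only [Function.comp]
  rw [eLpNorm_two_sq]
  refine lintegral_congr_ae ?_
  filter_upwards [Lp.coeFn_compMeasurePreserving g (hτ y)] with x hx
  rw [Pi.sub_apply, hx]
  rfl

theorem tendsto_eLpNorm_mollify_sub {d m : ℕ} (g : L2 d m) :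
    Tendsto (fun n => eLpNorm (mollify n g - ⇑g) 2 volume) atTop (𝓝 0) := by
  have h : Tendsto (fun n => eLpNorm (mollify n g - ⇑g) 2 volume ^ 2) atTop (𝓝 0) := by
    rw [ENNReal.tendsto_nhds_zero]
    intro δ hδ
    have h1 := (ENNReal.tendsto_nhds_zero.1 (tendsto_lintegral_translate_sub g)) δ hδ
    obtain ⟨r, hr, hr'⟩ := Metric.eventually_nhds_iff.1 h1
    filter_upwards [(tendsto_one_div_add_atTop_nhds_zero_nat (𝕜 := ℝ)).eventually
      (gt_mem_nhds hr)] with n hn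
    rw [eLpNorm_two_sq]
    refine lintegral_mollify_sub_le n g fun y hy => hr' ?_
    rw [dist_zero_right]
    exact hy.trans_lt hn
  have h2 := (ENNReal.continuous_rpow_const (y := (1 / 2 : ℝ))).tendsto 0 |>.comp h
  rw [ENNReal.zero_rpow_of_pos (by norm_num)] at h2
  refine h2.congr fun n => ?_
  simp only [Function.comp]
  rw [← ENNReal.rpow_natCast, ← ENNReal.rpow_mul]
  norm_num

theorem memLp_mollify {d m : ℕ} (n : ℕ) (g : L2 d m) : MemLp (mollify n g) 2 volume := by
  have hm : AEStronglyMeasurable (mollify n g) volume :=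
    (contDiff_mollify n g).continuous.aestronglyMeasurable
  have h : MemLp (mollify n g - ⇑g) 2 volume := by
    refine ⟨hm.sub (Lp.aestronglyMeasurable g), ?_⟩
    have hb : eLpNorm (mollify n g - ⇑g) 2 volume ^ 2 ≤ (2 * eLpNorm g 2 volume) ^ 2 := by
      rw [eLpNorm_two_sq]
      refine lintegral_mollify_sub_le n g fun y _ => ?_
      have e : ∫⁻ x, ‖g (x - y) - g x‖ₑ ^ 2 = eLpNorm ((fun x => g (x - y)) - ⇑g) 2 volume ^ 2 := by
        rw [eLpNorm_two_sq]; rfl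
      have hp := measurePreserving_sub_right (volume : Measure (RSp d)) y
      rw [e]
      gcongr
      refine (eLpNorm_sub_le ((Lp.aestronglyMeasurable g).comp_measurePreserving hp)
        (Lp.aestronglyMeasurable g) (by norm_num)).trans (le_of_eq ?_)
      rw [eLpNorm_comp_measurePreserving (Lp.aestronglyMeasurable g) hp, two_mul]
    have hlt : (2 * eLpNorm g 2 volume) ^ 2 < ⊤ := by
      have := (Lp.memLp g).2
      exact ENNReal.pow_lt_top (ENNReal.mul_lt_top (by simp) this)
    exact (ENNReal.pow_lt_top_iff.1 (hb.trans_lt hlt)).resolve_right (by norm_num)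
  have := h.add (Lp.memLp g)
  rwa [sub_add_cancel] at this

/-- The mollification of `g` as an element of `L²`. -/
noncomputable def mollifyL2 {d m : ℕ} (n : ℕ) (g : L2 d m) : L2 d m := (memLp_mollify n g).toLp _

theorem coeFn_mollifyL2 {d m : ℕ} (n : ℕ) (g : L2 d m) : mollifyL2 n g =ᵐ[volume] mollify n g :=
  (memLp_mollify n g).coeFn_toLp

theorem tendsto_mollifyL2 {d m : ℕ} (g : L2 d m) :
    Tendsto (fun n => mollifyL2 n g) atTop (𝓝 g) := by
  rw [Lp.tendsto_Lp_iff_tendsto_eLpNorm']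
  refine (tendsto_eLpNorm_mollify_sub g).congr fun n => eLpNorm_congr_ae ?_
  filter_upwards [coeFn_mollifyL2 n g] with x hx
  simp [hx]

/-- Classical derivatives commute with mollification. -/
theorem IsWeakPartial.fderiv_mollify {d m : ℕ} {k : Fin d} {f g : L2 d m}
    (h : IsWeakPartial k f g) (n : ℕ) (x : RSp d) :
    fderiv ℝ (mollify n f) x (EuclideanSpace.single k 1) = mollify n g x := by
  set e : RSp d := EuclideanSpace.single k 1
  have hd := ((hasCompactSupport_mollifier d n).hasFDerivAt_convolution_left
    (ContinuousLinearMap.lsmul ℝ ℝ) ((contDiff_mollifier d n).of_le (by simp))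
    (locallyIntegrable_L2 f) x).fderiv
  have hint : ConvolutionExistsAt (fderiv ℝ (mollifier d n)) f x
      ((ContinuousLinearMap.lsmul ℝ ℝ).precompL (RSp d)) volume :=
    ((hasCompactSupport_mollifier d n).fderiv ℝ).convolutionExists_left _
      ((contDiff_mollifier d n).continuous_fderiv (by simp)) (locallyIntegrable_L2 f) x
  have h1 : fderiv ℝ (mollify n f) x e = ∫ y, fderiv ℝ (mollifier d n) (x - y) e • f y := by
    unfold mollify
    rw [hd, convolution_eq_swap, ContinuousLinearMap.integral_apply]
    · rfl
    · have := hint.integrable_swap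
      exact this
  have hφ : ContDiff ℝ ∞ fun y => mollifier d n (x - y) :=
    (contDiff_mollifier d n).comp (contDiff_const.sub contDiff_id)
  have hc : HasCompactSupport fun y => mollifier d n (x - y) :=
    (hasCompactSupport_mollifier d n).comp_homeomorph (Homeomorph.subLeft x)
  -- The reflected mollifier `y ↦ mollifier (x - y)` is the test function; the reflection supplies
  -- the minus sign of the weak derivative.
  have hw := h _ hφ hc
  rw [h1, mollify_apply_swap, ← neg_inj, ← hw, ← integral_neg]
  refine integral_congr_ae (Eventually.of_forall fun y => ?_)
  have : fderiv ℝ (fun y => mollifier d n (x - y)) y e = - fderiv ℝ (mollifier d n) (x - y) e := by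
    have h2 : HasFDerivAt (fun y => mollifier d n (x - y))
        ((fderiv ℝ (mollifier d n) (x - y)).comp (-ContinuousLinearMap.id ℝ (RSp d))) y := by
      refine HasFDerivAt.comp y
        ((contDiff_mollifier d n).differentiable (by simp) (x - y)).hasFDerivAt ?_
      simpa using (hasFDerivAt_id y).const_sub x
    rw [h2.fderiv]
    simp
  change -(_ • f y) = (fderiv ℝ (fun y => mollifier d n (x - y)) y e) • f y
  rw [this, neg_smul]

/-! ### Stability of weak derivatives -/

theorem tendsto_integral_smul {d m : ℕ} {ι : Type*} {l : Filter ι} {φ : RSp d → ℝ}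
    (hφ : Continuous φ) (hc : HasCompactSupport φ) {f : ι → L2 d m} {f₀ : L2 d m}
    (hf : Tendsto f l (𝓝 f₀)) :
    Tendsto (fun n => ∫ x, φ x • f n x) l (𝓝 (∫ x, φ x • f₀ x)) := by
  have hm : MemLp φ 2 (volume : Measure (RSp d)) := hφ.memLp_of_hasCompactSupport hc
  have e : ∀ g : L2 d m, (ContinuousLinearMap.lsmul ℝ ℝ (E := RSp m)).lpPairing volume 2 2
      (hm.toLp φ) g = ∫ x, φ x • g x := by
    intro g
    rw [ContinuousLinearMap.lpPairing_eq_integral]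
    refine integral_congr_ae ?_
    filter_upwards [hm.coeFn_toLp] with x hx
    rw [hx]; rfl
  have := (((ContinuousLinearMap.lsmul ℝ ℝ (E := RSp m)).lpPairing volume 2 2
      (hm.toLp φ)).continuous.tendsto f₀).comp hf
  simpa only [e, Function.comp_def] using this

/-- Weak differentiation is a closed operator: for a fixed test function both sides of the defining
identity are continuous in `L²`. -/
theorem IsWeakPartial.of_tendsto {d m : ℕ} {k : Fin d} {ι : Type*} {l : Filter ι} [l.NeBot]
    {f g : ι → L2 d m} {f₀ g₀ : L2 d m} (h : ∀ᶠ n in l, IsWeakPartial k (f n) (g n))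
    (hf : Tendsto f l (𝓝 f₀)) (hg : Tendsto g l (𝓝 g₀)) : IsWeakPartial k f₀ g₀ := by
  intro φ hφ hc
  refine tendsto_nhds_unique (tendsto_integral_smul ?_ (hc.fderiv_apply (𝕜 := ℝ) _) hf)
    ((tendsto_integral_smul hφ.continuous hc hg).neg.congr' ?_)
  · exact (hφ.continuous_fderiv (by simp)).clm_apply continuous_const
  · filter_upwards [h] with n hn
    exact (hn φ hφ hc).symm

/-- The classical derivative of a `C¹` function is a weak derivative. -/
theorem isWeakPartial_of_contDiff {d m : ℕ} {k : Fin d} {f g : L2 d m} {u : RSp d → RSp m}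
    (hu : ContDiff ℝ 1 u) (hf : f =ᵐ[volume] u)
    (hg : g =ᵐ[volume] fun x => fderiv ℝ u x (EuclideanSpace.single k 1)) :
    IsWeakPartial k f g := by
  intro φ hφ hc
  set e : RSp d := EuclideanSpace.single k 1
  have e1 : (fun x => fderiv ℝ φ x e • f x) =ᵐ[volume] fun x => fderiv ℝ φ x e • u x := by
    filter_upwards [hf] with x hx
    rw [hx]
  have e2 : (fun x => φ x • g x) =ᵐ[volume] fun x => φ x • fderiv ℝ u x e := by
    filter_upwards [hg] with x hx
    rw [hx]
  have hcφ : Continuous fun x => fderiv ℝ φ x e :=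
    (hφ.continuous_fderiv (by simp)).clm_apply continuous_const
  have hcu : Continuous fun x => fderiv ℝ u x e :=
    (hu.continuous_fderiv (by simp)).clm_apply continuous_const
  rw [integral_congr_ae e1, integral_congr_ae e2]
  rw [integral_smul_fderiv_eq_neg_fderiv_smul_of_integrable, neg_neg]
  · exact (hcφ.smul hu.continuous).integrable_of_hasCompactSupport
      (hc.fderiv_apply (𝕜 := ℝ) e).smul_right
  · exact (hφ.continuous.smul hcu).integrable_of_hasCompactSupport hc.smul_right
  · exact (hφ.continuous.smul hu.continuous).integrable_of_hasCompactSupport hc.smul_right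
  · exact fun x _ => hφ.differentiable (by simp) x
  · exact fun x _ => hu.differentiable (by simp) x

/-! ### Dominated convergence and the chain rule -/

theorem tendsto_L2_of_dominated {d m : ℕ} {f : ℕ → L2 d m} {f₀ : L2 d m} {b : RSp d → ℝ}
    (hb : MemLp b 2 volume) (hle : ∀ n, ∀ᵐ x, ‖f n x - f₀ x‖ ≤ b x)
    (ht : ∀ᵐ x, Tendsto (fun n => f n x) atTop (𝓝 (f₀ x))) : Tendsto f atTop (𝓝 f₀) := by
  have h : Tendsto (fun n => eLpNorm (⇑(f n) - ⇑f₀) 2 volume ^ 2) atTop (𝓝 0) := by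
    simp only [eLpNorm_two_sq]
    rw [← lintegral_zero (α := RSp d) (μ := volume)]
    refine tendsto_lintegral_of_dominated_convergence' (fun x => ‖b x‖ₑ ^ 2) (fun n => ?_)
      (fun n => ?_) ?_ ?_
    · exact ((Lp.aestronglyMeasurable (f n)).sub (Lp.aestronglyMeasurable f₀)).enorm.pow_const 2
    · filter_upwards [hle n] with x hx
      gcongr
      rw [enorm_le_iff_norm_le, Pi.sub_apply]
      exact hx.trans (le_abs_self _)
    · rw [← eLpNorm_two_sq]
      exact (ENNReal.pow_lt_top hb.2).ne
    · filter_upwards [ht] with x hx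
      have h1 : Tendsto (fun n => ‖f n x - f₀ x‖ₑ) atTop (𝓝 0) := by
        have := ENNReal.tendsto_ofReal (tendsto_iff_norm_sub_tendsto_zero.1 hx)
        simpa only [ofReal_norm, ENNReal.ofReal_zero] using this
      have h2 := (ENNReal.continuous_pow 2).tendsto 0 |>.comp h1
      rwa [zero_pow two_ne_zero] at h2
  rw [Lp.tendsto_Lp_iff_tendsto_eLpNorm']
  have h2 := (ENNReal.continuous_rpow_const (y := (1 / 2 : ℝ))).tendsto 0 |>.comp h
  rw [ENNReal.zero_rpow_of_pos (by norm_num)] at h2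
  refine h2.congr fun n => ?_
  simp only [Function.comp]
  rw [← ENNReal.rpow_natCast, ← ENNReal.rpow_mul]
  norm_num

theorem memLp_clm_apply {d m : ℕ} {C : ℝ≥0} {T : RSp d → RSp m →L[ℝ] RSp m}
    (hT : AEStronglyMeasurable T volume) (hC : ∀ x, ‖T x‖ ≤ C) (g : L2 d m) :
    MemLp (fun x => T x (g x)) 2 volume := by
  refine MemLp.of_le_mul (c := C) (Lp.memLp g) ?_ (Eventually.of_forall fun x => ?_)
  · exact isBoundedBilinearMap_apply.continuous.comp_aestronglyMeasurable
      (hT.prodMk (Lp.aestronglyMeasurable g))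
  · exact ((T x).le_opNorm _).trans (by gcongr; exact hC x)

theorem memLp_fderiv_apply {d m : ℕ} {C : ℝ≥0} {F : RSp m → RSp m} (hF : ContDiff ℝ 1 F)
    (hL : LipschitzWith C F) (u g : L2 d m) :
    MemLp (fun x => fderiv ℝ F (u x) (g x)) 2 volume :=
  memLp_clm_apply ((hF.continuous_fderiv (by simp)).comp_aestronglyMeasurable
    (Lp.aestronglyMeasurable u)) (fun _ => norm_fderiv_le_of_lipschitz ℝ hL) g

/-- The chain rule for weak derivatives. -/
theorem IsWeakPartial.comp {d m : ℕ} {k : Fin d} {C : ℝ≥0} {F : RSp m → RSp m} {u g G : L2 d m}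
    (hF : ContDiff ℝ 1 F) (hL : LipschitzWith C F) (h0 : F 0 = 0) (h : IsWeakPartial k u g)
    (hG : G =ᵐ[volume] fun x => fderiv ℝ F (u x) (g x)) :
    IsWeakPartial k (hL.compLp h0 u) G := by
  have hM : ∀ n, MemLp (fun x => fderiv ℝ F (mollifyL2 n u x) (mollifyL2 n g x)) 2 volume :=
    fun n => memLp_fderiv_apply hF hL _ _
  have hM' : ∀ n, MemLp (fun x => fderiv ℝ F (mollifyL2 n u x) (g x)) 2 volume :=
    fun n => memLp_fderiv_apply hF hL _ _
  -- With mollified `uₙ`, `gₙ`, the derivative splits as `DF(uₙ) gₙ = DF(uₙ) g + DF(uₙ)(gₙ - g)`.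
  -- The first term converges by domination, since `uₙ → u` almost everywhere and `DF` is continuous
  -- and bounded.
  have hH : Tendsto (fun n => (hM' n).toLp _) atTop (𝓝 G) := by
    refine tendsto_L2_of_dominated (b := fun x => 2 * C * ‖g x‖) ?_ (fun n => ?_) ?_
    · exact (Lp.memLp g).norm.const_mul _
    · filter_upwards [(hM' n).coeFn_toLp, hG] with x h1 h2
      rw [h1, h2]
      refine (norm_sub_le _ _).trans ?_
      have e : ∀ ξ, ‖fderiv ℝ F ξ (g x)‖ ≤ C * ‖g x‖ := fun ξ =>
        (ContinuousLinearMap.le_opNorm _ _).trans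
          (by gcongr; exact norm_fderiv_le_of_lipschitz ℝ hL)
      linarith [e (mollifyL2 n u x), e (u x)]
    · have h1 : ∀ᵐ x, ∀ n, (hM' n).toLp _ x = fderiv ℝ F (mollifyL2 n u x) (g x) :=
        ae_all_iff.2 fun n => (hM' n).coeFn_toLp
      have h2 : ∀ᵐ x, ∀ n, mollifyL2 n u x = mollify n u x :=
        ae_all_iff.2 fun n => coeFn_mollifyL2 n u
      filter_upwards [h1, h2, hG, mollify_ae_tendsto u] with x h1 h2 h3 h4
      simp only [h1, h2, h3]
      have hc : Continuous fun ξ => fderiv ℝ F ξ (g x) :=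
        (hF.continuous_fderiv (by simp)).clm_apply continuous_const
      exact (hc.tendsto _).comp h4
  -- The second term is at most `C ‖gₙ - g‖`.
  have hD : Tendsto (fun n => (hM n).toLp _ - (hM' n).toLp _) atTop (𝓝 0) := by
    have hg := (tendsto_iff_norm_sub_tendsto_zero.1 (tendsto_mollifyL2 g)).const_mul (C : ℝ)
    rw [mul_zero] at hg
    refine squeeze_zero_norm (fun n => ?_) hg
    refine Lp.norm_le_mul_norm_of_ae_le_mul ?_
    filter_upwards [Lp.coeFn_sub ((hM n).toLp _) ((hM' n).toLp _), (hM n).coeFn_toLp,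
      (hM' n).coeFn_toLp, Lp.coeFn_sub (mollifyL2 n g) g] with x h1 h2 h3 h4
    rw [h1, Pi.sub_apply, h2, h3, h4, Pi.sub_apply, ← map_sub]
    exact (ContinuousLinearMap.le_opNorm _ _).trans
      (by gcongr; exact norm_fderiv_le_of_lipschitz ℝ hL)
  have hG' : Tendsto (fun n => (hM n).toLp _) atTop (𝓝 G) := by
    simpa using hD.add hH
  refine IsWeakPartial.of_tendsto (Eventually.of_forall fun n => ?_)
    (((hL.continuous_compLp h0).tendsto u).comp (tendsto_mollifyL2 u)) hG'
  have hs : ContDiff ℝ 1 (mollify n u) := (contDiff_mollify n u).of_le (by simp)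
  refine isWeakPartial_of_contDiff (u := F ∘ mollify n u) (hF.comp hs) ?_ ?_
  · filter_upwards [hL.coeFn_compLp h0 (mollifyL2 n u), coeFn_mollifyL2 n u] with x h1 h2
    simp only [Function.comp_apply] at h1 ⊢
    rw [h1, h2]
  · filter_upwards [(hM n).coeFn_toLp, coeFn_mollifyL2 n u, coeFn_mollifyL2 n g] with x h1 h2 h3
    rw [h1, fderiv_comp x (hF.differentiable (by simp) _) (hs.differentiable (by simp) _),
      ContinuousLinearMap.comp_apply, h.fderiv_mollify, h2, h3]

/-- The product rule for weak derivatives. -/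
theorem IsWeakPartial.smul_contDiff {d m : ℕ} {k : Fin d} {f g P Q : L2 d m} {χ : RSp d → ℝ}
    (hχ : ContDiff ℝ ∞ χ) (h : IsWeakPartial k f g)
    (hP : P =ᵐ[volume] fun x => χ x • f x)
    (hQ : Q =ᵐ[volume] fun x => χ x • g x + fderiv ℝ χ x (EuclideanSpace.single k 1) • f x) :
    IsWeakPartial k P Q := by
  intro φ hφ hc
  set e : RSp d := EuclideanSpace.single k 1
  have hcφ : Continuous fun x => fderiv ℝ φ x e :=
    (hφ.continuous_fderiv (by simp)).clm_apply continuous_const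
  have hcχ : Continuous fun x => fderiv ℝ χ x e :=
    (hχ.continuous_fderiv (by simp)).clm_apply continuous_const
  have hw := h (fun x => φ x * χ x) (hφ.mul hχ) hc.mul_right
  have e1 : ∀ x, fderiv ℝ (fun x => φ x * χ x) x e
      = χ x * fderiv ℝ φ x e + φ x * fderiv ℝ χ x e := by
    intro x
    rw [fderiv_fun_mul (hφ.differentiable (by simp) x) (hχ.differentiable (by simp) x)]
    simp [add_comm]
  have i1 : Integrable (fun x => (χ x * fderiv ℝ φ x e) • f x) volume :=
    integrable_smul_L2 f (hχ.continuous.mul hcφ) (hc.fderiv_apply (𝕜 := ℝ) e).mul_left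
  have i2 : Integrable (fun x => (φ x * fderiv ℝ χ x e) • f x) volume :=
    integrable_smul_L2 f (hφ.continuous.mul hcχ) hc.mul_right
  have i3 : Integrable (fun x => (φ x * χ x) • g x) volume :=
    integrable_smul_L2 g (hφ.continuous.mul hχ.continuous) hc.mul_right
  simp only [show (EuclideanSpace.single k 1 : RSp d) = e from rfl, e1, add_smul] at hw
  rw [integral_add i1 i2] at hw
  have e2 : (fun x => fderiv ℝ φ x e • P x) =ᵐ[volume]
      fun x => (χ x * fderiv ℝ φ x e) • f x := by
    filter_upwards [hP] with x hx
    rw [hx, smul_smul, mul_comm]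
  have e3 : (fun x => φ x • Q x) =ᵐ[volume]
      fun x => (φ x * χ x) • g x + (φ x * fderiv ℝ χ x e) • f x := by
    filter_upwards [hQ] with x hx
    rw [hx, smul_add, smul_smul, smul_smul]
  rw [integral_congr_ae e2, integral_congr_ae e3, integral_add i3 i2, neg_add, ← hw]
  abel

/-! ### Coordinatewise maps and the positive part -/

/-- The map applying `p` to each coordinate. -/
noncomputable def coordMap (m : ℕ) (p : ℝ → ℝ) (ξ : RSp m) : RSp m := WithLp.toLp 2 fun i => p (ξ i)

theorem norm_le_of_abs_le {m : ℕ} {ξ η : RSp m} (h : ∀ i, |ξ i| ≤ |η i|) : ‖ξ‖ ≤ ‖η‖ := by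
  rw [EuclideanSpace.norm_eq, EuclideanSpace.norm_eq]
  refine Real.sqrt_le_sqrt (Finset.sum_le_sum fun i _ => ?_)
  simp only [Real.norm_eq_abs]
  have := h i
  gcongr

theorem lipschitzWith_coordMap {m : ℕ} {p : ℝ → ℝ} (hp : LipschitzWith 1 p) :
    LipschitzWith 1 (coordMap m p) := by
  refine LipschitzWith.of_dist_le_mul fun ξ η => ?_
  rw [NNReal.coe_one, one_mul, dist_eq_norm, dist_eq_norm]
  refine norm_le_of_abs_le fun i => ?_
  have := hp.dist_le_mul (ξ i) (η i)
  simpa [Real.dist_eq, coordMap] using this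

theorem contDiff_coordMap {m : ℕ} {p : ℝ → ℝ} (hp : ContDiff ℝ 1 p) :
    ContDiff ℝ 1 (coordMap m p) := by
  rw [contDiff_euclidean]
  intro i
  exact hp.comp (EuclideanSpace.proj (𝕜 := ℝ) i).contDiff

theorem fderiv_coordMap {m : ℕ} {p : ℝ → ℝ} (hp : ContDiff ℝ 1 p) (ξ h : RSp m) (i : Fin m) :
    fderiv ℝ (coordMap m p) ξ h i = deriv p (ξ i) * h i := by
  have hd := ((contDiff_coordMap (m := m) hp).differentiable (by simp) ξ).hasFDerivAt
  have h1 := (EuclideanSpace.proj (𝕜 := ℝ) i).hasFDerivAt.comp ξ hd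
  have h2 := (hp.differentiable (by simp) (ξ i)).hasDerivAt.hasFDerivAt.comp ξ
    (EuclideanSpace.proj (𝕜 := ℝ) i).hasFDerivAt
  have := congrArg (fun L => L h) (h1.unique h2)
  simpa [mul_comm] using this

theorem lipschitzWith_max_zero : LipschitzWith 1 fun s : ℝ => max s 0 := by
  simpa using (LipschitzWith.id (α := ℝ)).max_const 0

/-- The componentwise positive part. -/
noncomputable def posPart {d m : ℕ} (u : L2 d m) : L2 d m :=
  (lipschitzWith_coordMap (m := m) lipschitzWith_max_zero).compLp
    (by ext i; simp [coordMap]) u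

theorem coeFn_posPart {d m : ℕ} (u : L2 d m) : ∀ᵐ x, ∀ i, posPart u x i = max (u x i) 0 := by
  filter_upwards [(lipschitzWith_coordMap (m := m) lipschitzWith_max_zero).coeFn_compLp
    (by ext i; simp [coordMap]) u] with x hx i
  rw [posPart, hx]; rfl

/-- Smooth approximations of the positive part. -/
noncomputable def smoothPos (δ s : ℝ) : ℝ := (s + Real.sqrt (s ^ 2 + δ ^ 2) - δ) / 2

theorem hasDerivAt_smoothPos {δ : ℝ} (hδ : 0 < δ) (s : ℝ) :
    HasDerivAt (smoothPos δ) ((1 + s / Real.sqrt (s ^ 2 + δ ^ 2)) / 2) s := by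
  have h0 : s ^ 2 + δ ^ 2 ≠ 0 := by positivity
  have h1 : HasDerivAt (fun s : ℝ => s ^ 2 + δ ^ 2) (2 * s) s := by
    simpa using (hasDerivAt_pow 2 s).add_const (δ ^ 2)
  have h2 := (((hasDerivAt_id s).add (h1.sqrt h0)).sub_const δ).div_const 2
  refine h2.congr_deriv ?_
  congr 2
  rw [mul_div_mul_left _ _ two_ne_zero]

theorem contDiff_smoothPos {δ : ℝ} (hδ : 0 < δ) : ContDiff ℝ 1 (smoothPos δ) := by
  have h : ContDiff ℝ 1 fun s : ℝ => Real.sqrt (s ^ 2 + δ ^ 2) :=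
    ContDiff.sqrt (by fun_prop) fun s => by positivity
  unfold smoothPos
  fun_prop

theorem abs_div_sqrt_le_one (s δ : ℝ) : |s / Real.sqrt (s ^ 2 + δ ^ 2)| ≤ 1 := by
  rw [abs_div, abs_of_nonneg (Real.sqrt_nonneg _)]
  refine div_le_one_of_le₀ ?_ (Real.sqrt_nonneg _)
  exact Real.abs_le_sqrt (by nlinarith [sq_nonneg δ])

theorem abs_deriv_smoothPos_le {δ : ℝ} (hδ : 0 < δ) (s : ℝ) : |deriv (smoothPos δ) s| ≤ 1 := by
  rw [(hasDerivAt_smoothPos hδ s).deriv]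
  have := abs_le.1 (abs_div_sqrt_le_one s δ)
  rw [abs_le]
  constructor <;> linarith

theorem lipschitzWith_smoothPos {δ : ℝ} (hδ : 0 < δ) : LipschitzWith 1 (smoothPos δ) := by
  refine lipschitzWith_of_nnnorm_deriv_le ((contDiff_smoothPos hδ).differentiable (by simp))
    fun s => ?_
  rw [← NNReal.coe_le_coe, coe_nnnorm]
  exact abs_deriv_smoothPos_le hδ s

theorem smoothPos_zero {δ : ℝ} (hδ : 0 < δ) : smoothPos δ 0 = 0 := by
  simp [smoothPos, Real.sqrt_sq hδ.le]

theorem tendsto_smoothPos (s : ℝ) :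
    Tendsto (fun n : ℕ => smoothPos (1 / ((n : ℝ) + 1)) s) atTop (𝓝 (max s 0)) := by
  have hc : Continuous fun δ : ℝ => smoothPos δ s := by unfold smoothPos; fun_prop
  have h := (hc.tendsto 0).comp (tendsto_one_div_add_atTop_nhds_zero_nat (𝕜 := ℝ))
  have e : smoothPos 0 s = max s 0 := by
    simp only [smoothPos, ne_eq, OfNat.ofNat_ne_zero, not_false_eq_true, zero_pow, add_zero,
      Real.sqrt_sq_eq_abs, sub_zero]
    rcases le_total s 0 with h | h
    · rw [abs_of_nonpos h, max_eq_right h]; ring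
    · rw [abs_of_nonneg h, max_eq_left h]; ring
  rwa [e] at h

/-- The a.e. derivative of the positive part (`1 / 2` at the origin). -/
noncomputable def posSlope (s : ℝ) : ℝ := (1 + s / |s|) / 2

theorem posSlope_nonneg (s : ℝ) : 0 ≤ posSlope s := by
  -- At `δ = 0` the square root is `|s|`; the quotient `0 / |0|` is `0`, so `s = 0` is covered.
  have := abs_le.1 (abs_div_sqrt_le_one s 0)
  simp only [ne_eq, OfNat.ofNat_ne_zero, not_false_eq_true, zero_pow, add_zero,
    Real.sqrt_sq_eq_abs] at this
  unfold posSlope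
  linarith

theorem posSlope_le_one (s : ℝ) : posSlope s ≤ 1 := by
  have := abs_le.1 (abs_div_sqrt_le_one s 0)
  simp only [ne_eq, OfNat.ofNat_ne_zero, not_false_eq_true, zero_pow, add_zero,
    Real.sqrt_sq_eq_abs] at this
  unfold posSlope
  linarith

theorem tendsto_deriv_smoothPos (s : ℝ) :
    Tendsto (fun n : ℕ => deriv (smoothPos (1 / ((n : ℝ) + 1))) s) atTop (𝓝 (posSlope s)) := by
  have e : ∀ n : ℕ, deriv (smoothPos (1 / ((n : ℝ) + 1))) s
      = (1 + s / Real.sqrt (s ^ 2 + (1 / ((n : ℝ) + 1)) ^ 2)) / 2 := fun n =>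
    (hasDerivAt_smoothPos (by positivity) s).deriv
  simp only [e, posSlope]
  rcases eq_or_ne s 0 with rfl | hs
  · simp
  have hc : Tendsto (fun δ : ℝ => Real.sqrt (s ^ 2 + δ ^ 2)) (𝓝 0) (𝓝 |s|) := by
    have : Continuous fun δ : ℝ => Real.sqrt (s ^ 2 + δ ^ 2) := by fun_prop
    simpa [Real.sqrt_sq_eq_abs] using this.tendsto 0
  have h := hc.comp (tendsto_one_div_add_atTop_nhds_zero_nat (𝕜 := ℝ))
  exact ((tendsto_const_nhds.div h (abs_ne_zero.2 hs)).const_add 1).div_const 2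

theorem tendsto_euclidean {m : ℕ} {ι : Type*} {l : Filter ι} {f : ι → RSp m} {a : RSp m}
    (h : ∀ i, Tendsto (fun n => f n i) l (𝓝 (a i))) : Tendsto f l (𝓝 a) := by
  have h1 : Tendsto (fun n => WithLp.ofLp (f n)) l (𝓝 (WithLp.ofLp a)) := tendsto_pi_nhds.2 h
  exact ((PiLp.continuous_toLp 2 fun _ : Fin m => ℝ).tendsto _).comp h1

/-- The positive part has the expected weak derivatives. -/
theorem IsWeakPartial.posPart {d m : ℕ} {k : Fin d} {u g : L2 d m} (h : IsWeakPartial k u g) :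
    ∃ G : L2 d m, IsWeakPartial k (posPart u) G ∧
      ∀ᵐ x, ∀ i, G x i = posSlope (u x i) * g x i := by
  have hδ : ∀ n : ℕ, 0 < 1 / ((n : ℝ) + 1) := fun n => by positivity
  have hL : ∀ n : ℕ, LipschitzWith 1 (coordMap m (smoothPos (1 / ((n : ℝ) + 1)))) := fun n =>
    lipschitzWith_coordMap (lipschitzWith_smoothPos (hδ n))
  have h0 : ∀ n : ℕ, coordMap m (smoothPos (1 / ((n : ℝ) + 1))) 0 = 0 := fun n => by
    ext i; exact smoothPos_zero (hδ n)
  have hM : ∀ n : ℕ, MemLp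
      (fun x => fderiv ℝ (coordMap m (smoothPos (1 / ((n : ℝ) + 1)))) (u x) (g x)) 2 volume :=
    fun n => memLp_fderiv_apply (contDiff_coordMap (contDiff_smoothPos (hδ n))) (hL n) u g
  -- The derivative is defined as the pointwise limit of chain-rule derivatives. Where a component
  -- of `u` vanishes the limiting slope is `1 / 2`; it need not be known that the gradient vanishes
  -- there, since later only `0 ≤ posSlope ≤ 1` matters.
  have hlim : ∀ x, Tendsto (fun n : ℕ =>
      fderiv ℝ (coordMap m (smoothPos (1 / ((n : ℝ) + 1)))) (u x) (g x)) atTop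
      (𝓝 (WithLp.toLp 2 fun i => posSlope (u x i) * g x i)) := by
    refine fun x => tendsto_euclidean fun i => ?_
    simp only [fderiv_coordMap (contDiff_smoothPos (hδ _))]
    exact (tendsto_deriv_smoothPos _).mul_const _
  have hle : ∀ x, ‖(WithLp.toLp 2 fun i => posSlope (u x i) * g x i : RSp m)‖ ≤ ‖g x‖ := by
    refine fun x => norm_le_of_abs_le fun i => ?_
    simp only [abs_mul]
    rw [abs_of_nonneg (posSlope_nonneg _)]
    exact mul_le_of_le_one_left (abs_nonneg _) (posSlope_le_one _)
  have hG : MemLp (fun x => (WithLp.toLp 2 fun i => posSlope (u x i) * g x i : RSp m)) 2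
      volume := by
    refine MemLp.of_le (Lp.memLp g) ?_ (Eventually.of_forall hle)
    exact aestronglyMeasurable_of_tendsto_ae atTop (fun n => (hM n).1) (Eventually.of_forall hlim)
  refine ⟨hG.toLp _, ?_, ?_⟩
  · refine IsWeakPartial.of_tendsto (l := atTop) (Eventually.of_forall fun n =>
      h.comp (contDiff_coordMap (contDiff_smoothPos (hδ n))) (hL n) (h0 n) (hM n).coeFn_toLp)
      ?_ ?_
    · have h1 : ∀ᵐ x, ∀ n, (hL n).compLp (h0 n) u x = coordMap m (smoothPos _) (u x) :=
        ae_all_iff.2 fun n => (hL n).coeFn_compLp (h0 n) u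
      refine tendsto_L2_of_dominated (b := fun x => 2 * ‖u x‖) ?_ (fun n => ?_) ?_
      · exact (Lp.memLp u).norm.const_mul _
      · filter_upwards [h1, coeFn_posPart u] with x h1 h2
        refine (norm_sub_le _ _).trans ?_
        have e1 : ‖VSchrodinger.posPart u x‖ ≤ ‖u x‖ := norm_le_of_abs_le fun i => by
          rw [h2, abs_of_nonneg (le_max_right _ _)]
          exact max_le (le_abs_self _) (abs_nonneg _)
        have e2 := (hL n).dist_le_mul (u x) 0
        rw [h0 n, dist_zero_right, dist_zero_right, ← h1 n] at e2
        simp only [NNReal.coe_one, one_mul] at e2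
        linarith
      · filter_upwards [h1, coeFn_posPart u] with x h1 h2
        simp only [h1]
        refine tendsto_euclidean fun i => ?_
        rw [h2]
        exact tendsto_smoothPos _
    · have h1 : ∀ᵐ x, ∀ n, (hM n).toLp _ x = fderiv ℝ (coordMap m (smoothPos _)) (u x) (g x) :=
        ae_all_iff.2 fun n => (hM n).coeFn_toLp
      refine tendsto_L2_of_dominated (b := fun x => 2 * ‖g x‖) ?_ (fun n => ?_) ?_
      · exact (Lp.memLp g).norm.const_mul _
      · filter_upwards [h1, hG.coeFn_toLp] with x h1 h2
        rw [h1, h2]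
        refine (norm_sub_le _ _).trans ?_
        have e2 : ‖fderiv ℝ (coordMap m (smoothPos (1 / ((n : ℝ) + 1)))) (u x) (g x)‖ ≤ ‖g x‖ :=
          norm_le_of_abs_le fun i => by
            rw [fderiv_coordMap (contDiff_smoothPos (hδ n)), abs_mul]
            exact mul_le_of_le_one_left (abs_nonneg _) (abs_deriv_smoothPos_le (hδ n) _)
        linarith [hle x]
      · filter_upwards [h1, hG.coeFn_toLp] with x h1 h2
        simp only [h1, h2]
        exact hlim x
  · filter_upwards [hG.coeFn_toLp] with x hx i
    rw [hx]

/-! ### The form in terms of inner products -/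

theorem inner_eq_integral_sum {d m : ℕ} (f g : L2 d m) :
    inner ℝ f g = ∫ x, ∑ i, f x i * g x i := by
  rw [L2.inner_def]
  refine integral_congr_ae (Eventually.of_forall fun x => ?_)
  simp only [PiLp.inner_apply, RCLike.inner_apply, conj_trivial]
  exact Finset.sum_congr rfl fun i _ => mul_comm _ _

theorem integrable_sum_mul {d m : ℕ} (f g : L2 d m) :
    Integrable (fun x => ∑ i, f x i * g x i) volume := by
  refine (L2.integrable_inner (𝕜 := ℝ) f g).congr (Eventually.of_forall fun x => ?_)
  simp only [PiLp.inner_apply, RCLike.inner_apply, conj_trivial]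
  exact Finset.sum_congr rfl fun i _ => mul_comm _ _

theorem form_eq {d m : ℕ} {W : Potential d m} {f g : L2 d m} (hf : f ∈ formDomain W)
    (hg : g ∈ formDomain W) :
    form W f g = (∑ k, inner ℝ (weakPartial k f) (weakPartial k g))
      + ∫ x, matPair (W.toFun x) (f x) (g x) := by
  unfold form formDensity
  rw [integral_add (integrable_grad f g) (integrable_matPair W hf.2 hg.2)]
  congr 1
  simp only [inner_eq_integral_sum]
  rw [← integral_finsetSum _ fun k _ => integrable_sum_mul _ _]
  refine integral_congr_ae (Eventually.of_forall fun x => ?_)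
  exact Finset.sum_comm

theorem isWeakPartial_weakPartial {d m : ℕ} {W : Potential d m} {f : L2 d m}
    (hf : f ∈ formDomain W) (k : Fin d) : IsWeakPartial k f (weakPartial k f) := by
  obtain ⟨g, hg⟩ := hf.1 k
  rwa [hg.weakPartial_eq]

theorem weakPartial_sub {d m : ℕ} {W : Potential d m} (k : Fin d) {f g : L2 d m}
    (hf : f ∈ formDomain W) (hg : g ∈ formDomain W) :
    weakPartial k (f - g) = weakPartial k f - weakPartial k g := by
  rw [sub_eq_add_neg, ← neg_one_smul ℝ g, weakPartial_add k hf ((formDomain W).smul_mem _ hg),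
    weakPartial_smul k _ hg, neg_one_smul, ← sub_eq_add_neg]

/-- Separates gradient from potential: `L²` convergence of the weak gradients handles the first, so
approximation and completeness arguments need only treat the potential term. -/
theorem tendsto_form_sub {d m : ℕ} {W : Potential d m} {w : L2 d m} {f : ℕ → L2 d m}
    (hw : w ∈ formDomain W) (hf : ∀ n, f n ∈ formDomain W)
    (hg : ∀ k, Tendsto (fun n => weakPartial k (f n)) atTop (𝓝 (weakPartial k w)))
    (hp : Tendsto (fun n => ∫ x, matPair (W.toFun x) ((w - f n) x) ((w - f n) x)) atTop (𝓝 0)) :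
    Tendsto (fun n => form W (w - f n) (w - f n)) atTop (𝓝 0) := by
  have hd : ∀ n, w - f n ∈ formDomain W := fun n => (formDomain W).sub_mem hw (hf n)
  have h1 : Tendsto (fun n => ∑ k : Fin d, ‖weakPartial k (w - f n)‖ ^ 2) atTop (𝓝 0) := by
    rw [← Finset.sum_const_zero (ι := Fin d) (s := Finset.univ)]
    refine tendsto_finsetSum _ fun k _ => ?_
    have := (((hg k).const_sub (weakPartial k w)).norm).pow 2
    simpa [weakPartial_sub k hw (hf _)] using this
  have := h1.add hp
  rw [add_zero] at this
  refine this.congr fun n => ?_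
  rw [form_eq (hd n) (hd n)]
  simp only [real_inner_self_eq_norm_sq]

theorem mem_formClosure_of_tendsto {d m : ℕ} {W : Potential d m} {w : L2 d m} {f : ℕ → L2 d m}
    (hw : w ∈ formDomain W) (hf : ∀ n, f n ∈ formClosure W)
    (ht : Tendsto (fun n => form W (w - f n) (w - f n)) atTop (𝓝 0)) : w ∈ formClosure W := by
  refine ⟨hw, fun δ hδ => ?_⟩
  -- The form of a sum is at most twice the sum of the forms, so two errors below `δ² / 4` add up to
  -- less than `δ²`.
  obtain ⟨n, hn⟩ := (ht.eventually (gt_mem_nhds (show 0 < δ ^ 2 / 4 by positivity))).exists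
  obtain ⟨φ, hφ, h⟩ := (hf n).2 (δ / 2) (by positivity)
  refine ⟨φ, hφ, ?_⟩
  unfold formNorm at *
  rw [Real.sqrt_lt' (by positivity)] at *
  have := form_add_self_le W ((formDomain W).sub_mem hw (hf n).1)
    ((formDomain W).sub_mem (hf n).1 (hφ.mem_formDomain W))
  rw [sub_add_sub_cancel] at this
  nlinarith

/-! ### Cutoff functions -/

/-- A fixed smooth cutoff function, equal to `1` on the unit ball. -/
noncomputable def unitBump (n : ℕ) : ContDiffBump (0 : RSp n) := ⟨1, 2, one_pos, one_lt_two⟩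

/-- A smooth cutoff function, equal to `1` on the ball of radius `R + 1`. -/
noncomputable def cutoff (n R : ℕ) (x : RSp n) : ℝ := unitBump n (((R : ℝ) + 1)⁻¹ • x)

theorem cutoff_nonneg (n R : ℕ) (x : RSp n) : 0 ≤ cutoff n R x := (unitBump n).nonneg

theorem cutoff_le_one (n R : ℕ) (x : RSp n) : cutoff n R x ≤ 1 := (unitBump n).le_one

theorem contDiff_cutoff (n R : ℕ) : ContDiff ℝ ∞ (cutoff n R) :=
  (unitBump n).contDiff.comp (contDiff_const_smul _)

theorem cutoff_eq_one {n R : ℕ} {x : RSp n} (hx : ‖x‖ ≤ R + 1) : cutoff n R x = 1 := by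
  refine (unitBump n).one_of_mem_closedBall ?_
  rw [mem_closedBall_zero_iff, norm_smul, norm_inv, Real.norm_of_nonneg (by positivity)]
  change _ ≤ (1 : ℝ)
  rw [inv_mul_le_iff₀ (by positivity)]
  linarith

theorem cutoff_eq_zero {n R : ℕ} {x : RSp n} (hx : 2 * ((R : ℝ) + 1) ≤ ‖x‖) :
    cutoff n R x = 0 := by
  refine (unitBump n).zero_of_le_dist ?_
  rw [dist_zero_right, norm_smul, norm_inv, Real.norm_of_nonneg (by positivity)]
  change (2 : ℝ) ≤ _
  rw [le_inv_mul_iff₀ (by positivity)]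
  linarith

theorem cutoff_eventuallyEq_one {n : ℕ} (x : RSp n) :
    ∀ᶠ R : ℕ in atTop, cutoff n R =ᶠ[𝓝 x] fun _ => 1 := by
  obtain ⟨N, hN⟩ := exists_nat_gt ‖x‖
  filter_upwards [eventually_ge_atTop N] with R hR
  have hR' : (N : ℝ) ≤ R := by exact_mod_cast hR
  have : ‖x‖ < (R : ℝ) + 1 := by linarith
  filter_upwards [(continuous_norm.tendsto x).eventually (gt_mem_nhds this)] with y hy
  exact cutoff_eq_one hy.le

theorem tendsto_cutoff {n : ℕ} (x : RSp n) :
    Tendsto (fun R : ℕ => cutoff n R x) atTop (𝓝 1) := by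
  refine tendsto_const_nhds.congr' ?_
  filter_upwards [cutoff_eventuallyEq_one x] with R hR
  exact hR.self_of_nhds.symm

/-- The inner dilation by `(R + 1)⁻¹ ≤ 1` can only lower the Lipschitz constant of the unit bump. -/
theorem exists_lipschitzWith_cutoff (n : ℕ) : ∃ C, ∀ R, LipschitzWith C (cutoff n R) := by
  obtain ⟨C, hC⟩ := ContDiff.lipschitzWith_of_hasCompactSupport (unitBump n).hasCompactSupport
    ((unitBump n).contDiff (n := 1)) one_ne_zero
  refine ⟨C, fun R => LipschitzWith.of_dist_le_mul fun x y => ?_⟩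
  refine (hC.dist_le_mul _ _).trans ?_
  gcongr
  rw [dist_eq_norm, dist_eq_norm, ← smul_sub, norm_smul, norm_inv,
    Real.norm_of_nonneg (by positivity)]
  refine mul_le_of_le_one_left (norm_nonneg _) (inv_le_one_of_one_le₀ ?_)
  linarith [(R.cast_nonneg : (0 : ℝ) ≤ R)]

/-- The identity map cut off at infinity. -/
noncomputable def truncId (m R : ℕ) (ξ : RSp m) : RSp m := cutoff m R ξ • ξ

theorem contDiff_truncId (m R : ℕ) : ContDiff ℝ 1 (truncId m R) :=
  ((contDiff_cutoff m R).of_le (by simp)).smul contDiff_id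

theorem truncId_zero (m R : ℕ) : truncId m R 0 = 0 := smul_zero _

theorem norm_truncId_le (m R : ℕ) (ξ : RSp m) : ‖truncId m R ξ‖ ≤ 2 * ((R : ℝ) + 1) := by
  rcases le_total (2 * ((R : ℝ) + 1)) ‖ξ‖ with h | h
  · rw [truncId, cutoff_eq_zero h, zero_smul, norm_zero]
    positivity
  · rw [truncId, norm_smul, Real.norm_of_nonneg (cutoff_nonneg _ _ _)]
    exact (mul_le_of_le_one_left (norm_nonneg _) (cutoff_le_one _ _ _)).trans h

/-- `truncId m R` is a fixed compactly supported map conjugated by the dilation of factor `R + 1`,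
and such a conjugation preserves Lipschitz constants. Uniformity in `R` provides the dominating
function when `R → ∞`. -/
theorem exists_lipschitzWith_truncId (m : ℕ) : ∃ C, ∀ R, LipschitzWith C (truncId m R) := by
  have hc : HasCompactSupport fun ξ : RSp m => unitBump m ξ • ξ :=
    (unitBump m).hasCompactSupport.smul_right
  obtain ⟨C, hC⟩ := ContDiff.lipschitzWith_of_hasCompactSupport hc
    ((unitBump m).contDiff.smul (contDiff_id (n := 1))) one_ne_zero
  refine ⟨C, fun R => LipschitzWith.of_dist_le_mul fun x y => ?_⟩
  have hR : (0 : ℝ) < R + 1 := by positivity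
  have e : ∀ ξ, truncId m R ξ = ((R : ℝ) + 1) •
      (unitBump m (((R : ℝ) + 1)⁻¹ • ξ) • (((R : ℝ) + 1)⁻¹ • ξ)) := by
    intro ξ
    rw [smul_comm, smul_inv_smul₀ hR.ne']
    rfl
  have h := hC.dist_le_mul (((R : ℝ) + 1)⁻¹ • x) (((R : ℝ) + 1)⁻¹ • y)
  rw [e, e, dist_smul₀, Real.norm_of_nonneg hR.le]
  rw [dist_smul₀, norm_inv, Real.norm_of_nonneg hR.le] at h
  calc ((R : ℝ) + 1) * _ ≤ ((R : ℝ) + 1) * (C * (((R : ℝ) + 1)⁻¹ * dist x y)) := by gcongr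
    _ = C * dist x y := by field_simp

theorem tendsto_fderiv_truncId {m : ℕ} (ξ h : RSp m) :
    Tendsto (fun R : ℕ => fderiv ℝ (truncId m R) ξ h) atTop (𝓝 h) := by
  refine tendsto_const_nhds.congr' ?_
  filter_upwards [cutoff_eventuallyEq_one ξ] with R hR
  have : truncId m R =ᶠ[𝓝 ξ] id := by
    filter_upwards [hR] with y hy
    rw [truncId, hy, one_smul, id]
  rw [this.fderiv_eq, fderiv_id, ContinuousLinearMap.id_apply]

/-! ### Test functions are dense in the maximal form domain -/

theorem matPair_smul_smul {m : ℕ} (A : Matrix (Fin m) (Fin m) ℝ) (c : ℝ) (ξ : RSp m) :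
    matPair A (c • ξ) (c • ξ) = c ^ 2 * matPair A ξ ξ := by
  simp only [matPair, Finset.mul_sum]
  refine Finset.sum_congr rfl fun i _ => Finset.sum_congr rfl fun j _ => ?_
  simp only [PiLp.smul_apply, smul_eq_mul]; ring

theorem integrable_matPair_of_scaled {d m : ℕ} (W : Potential d m) {w f : L2 d m}
    {c : RSp d → ℝ} (hw : Integrable (fun x => matPair (W.toFun x) (w x) (w x)) volume)
    (hc : ∀ x, |c x| ≤ 1) (hf : f =ᵐ[volume] fun x => c x • w x) :
    Integrable (fun x => matPair (W.toFun x) (f x) (f x)) volume := by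
  refine hw.mono' (aestronglyMeasurable_matPair W f f) ?_
  filter_upwards [W.nonneg, hf] with x hp hx
  rw [hx, matPair_smul_smul, Real.norm_of_nonneg (mul_nonneg (sq_nonneg _) (hp _))]
  exact mul_le_of_le_one_left (hp _) ((sq_le_one_iff_abs_le_one _).2 (hc x))

/-- The remainder `w - fₙ` is `(1 - cₙ) w`, so its potential energy density is `(1 - cₙ)²` times
that of `w`, which dominates it. Serves both the truncation of values and the cutoff in space. -/
theorem tendsto_integral_matPair_of_scaled {d m : ℕ} (W : Potential d m) {w : L2 d m}
    {f : ℕ → L2 d m} {c : ℕ → RSp d → ℝ}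
    (hw : Integrable (fun x => matPair (W.toFun x) (w x) (w x)) volume)
    (hc0 : ∀ n x, 0 ≤ c n x) (hc1 : ∀ n x, c n x ≤ 1)
    (hc : ∀ x, Tendsto (fun n => c n x) atTop (𝓝 1))
    (hf : ∀ n, f n =ᵐ[volume] fun x => c n x • w x) :
    Tendsto (fun n => ∫ x, matPair (W.toFun x) ((w - f n) x) ((w - f n) x)) atTop (𝓝 0) := by
  have e : ∀ n, ∀ᵐ x, matPair (W.toFun x) ((w - f n) x) ((w - f n) x)
      = (1 - c n x) ^ 2 * matPair (W.toFun x) (w x) (w x) := by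
    intro n
    filter_upwards [Lp.coeFn_sub w (f n), hf n] with x h1 h2
    rw [h1, Pi.sub_apply, h2, ← matPair_smul_smul, sub_smul, one_smul]
  rw [← integral_zero (RSp d) ℝ (μ := volume)]
  refine tendsto_integral_of_dominated_convergence _
    (fun n => aestronglyMeasurable_matPair W _ _) hw (fun n => ?_) ?_
  · filter_upwards [e n, W.nonneg] with x hx hp
    rw [hx, Real.norm_of_nonneg (mul_nonneg (sq_nonneg _) (hp _))]
    refine mul_le_of_le_one_left (hp _) ?_
    have := hc0 n x
    have := hc1 n x
    nlinarith
  · filter_upwards [ae_all_iff.2 e] with x hx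
    simp only [hx]
    have := (((hc x).const_sub 1).pow 2).mul_const (matPair (W.toFun x) (w x) (w x))
    simpa using this

theorem norm_mollify_le {d m : ℕ} {w : L2 d m} {C : ℝ} (hC : ∀ᵐ x, ‖w x‖ ≤ C) (n : ℕ)
    (x : RSp d) : ‖mollify n w x‖ ≤ C := by
  have h : ∀ᵐ y, ‖w (x - y)‖ ≤ C :=
    (Measure.measurePreserving_sub_left volume x).quasiMeasurePreserving.ae hC
  calc ‖mollify n w x‖ ≤ ∫ y, mollifier d n y * C := by
        rw [mollify_apply]
        refine norm_integral_le_of_norm_le ((integrable_mollifier d n).mul_const _) ?_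
        filter_upwards [h] with y hy
        rw [norm_smul, Real.norm_of_nonneg (mollifier_nonneg d n y)]
        exact mul_le_mul_of_nonneg_left hy (mollifier_nonneg d n y)
    _ = C := by rw [integral_mul_const, integral_mollifier, one_mul]

theorem mollify_eq_zero {d m : ℕ} {w : L2 d m} {R : ℝ} (hR : ∀ᵐ x, R ≤ ‖x‖ → w x = 0) (n : ℕ)
    {x : RSp d} (hx : R + 1 ≤ ‖x‖) : mollify n w x = 0 := by
  have h : ∀ᵐ y, R ≤ ‖x - y‖ → w (x - y) = 0 :=
    (Measure.measurePreserving_sub_left volume x).quasiMeasurePreserving.ae hR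
  rw [mollify_apply]
  refine integral_eq_zero_of_ae ?_
  filter_upwards [h] with y hy
  rcases le_total (1 / ((n : ℝ) + 1)) ‖y‖ with h1 | h1
  · simp [mollifier_eq_zero h1]
  · have h2 : (1 : ℝ) / ((n : ℝ) + 1) ≤ 1 := by
      rw [div_le_one (by positivity)]
      linarith [(n.cast_nonneg : (0 : ℝ) ≤ n)]
    have h3 := norm_sub_norm_le x y
    rw [hy (by linarith)]
    simp

theorem isTest_mollifyL2 {d m : ℕ} {w : L2 d m} {R : ℝ} (hR : ∀ᵐ x, R ≤ ‖x‖ → w x = 0) (n : ℕ) :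
    IsTest (mollifyL2 n w) := by
  refine ⟨mollify n w, coeFn_mollifyL2 n w, ?_, contDiff_mollify n w⟩
  refine HasCompactSupport.intro (isCompact_closedBall (0 : RSp d) (R + 1)) fun x hx => ?_
  rw [mem_closedBall_zero_iff, not_le] at hx
  exact mollify_eq_zero hR n hx.le

theorem IsWeakPartial.mollifyL2 {d m : ℕ} {k : Fin d} {f g : L2 d m} (h : IsWeakPartial k f g)
    (n : ℕ) : IsWeakPartial k (mollifyL2 n f) (mollifyL2 n g) := by
  refine isWeakPartial_of_contDiff ((contDiff_mollify n f).of_le (by simp))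
    (coeFn_mollifyL2 n f) ?_
  filter_upwards [coeFn_mollifyL2 n g] with x hx
  rw [hx, h.fderiv_mollify]

theorem abs_coord_le {m : ℕ} (ξ : RSp m) (i : Fin m) : |ξ i| ≤ ‖ξ‖ := by
  simpa using PiLp.norm_apply_le ξ i

theorem abs_matPair_le_sum {m : ℕ} (A : Matrix (Fin m) (Fin m) ℝ) {ξ : RSp m} {C : ℝ}
    (h : ‖ξ‖ ≤ C) : |matPair A ξ ξ| ≤ (∑ i, ∑ j, |A i j|) * C ^ 2 := by
  have hC : 0 ≤ C := (norm_nonneg _).trans h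
  rw [Finset.sum_mul, matPair]
  refine (Finset.abs_sum_le_sum_abs _ _).trans (Finset.sum_le_sum fun i _ => ?_)
  rw [Finset.sum_mul]
  refine (Finset.abs_sum_le_sum_abs _ _).trans (Finset.sum_le_sum fun j _ => ?_)
  rw [abs_mul, abs_mul, mul_assoc, sq]
  have h1 := (abs_coord_le ξ i).trans h
  have h2 := (abs_coord_le ξ j).trans h
  gcongr

theorem continuous_matPair_self {m : ℕ} (A : Matrix (Fin m) (Fin m) ℝ) :
    Continuous fun ξ : RSp m => matPair A ξ ξ := by
  unfold matPair
  fun_prop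

/-- Mollifications of `w` are test functions with the same sup bound and support in a fixed larger
ball. Potential energies are thus dominated by a constant times the entries of `W` on that ball,
which is where local integrability enters. -/
theorem mem_formClosure_of_bounded {d m : ℕ} {W : Potential d m} {w : L2 d m}
    (hw : w ∈ formDomain W) {C R : ℝ} (hC : ∀ᵐ x, ‖w x‖ ≤ C) (hR : ∀ᵐ x, R ≤ ‖x‖ → w x = 0) :
    w ∈ formClosure W := by
  refine mem_formClosure_of_tendsto (f := fun n => mollifyL2 n w) hw
    (fun n => (isTest_mollifyL2 hR n).mem_formClosure W) ?_
  refine tendsto_form_sub hw (fun n => (isTest_mollifyL2 hR n).mem_formDomain W) (fun k => ?_) ?_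
  · have h := isWeakPartial_weakPartial hw k
    simp only [fun n => (h.mollifyL2 n).weakPartial_eq]
    exact tendsto_mollifyL2 _
  · have e : ∀ᵐ x, ∀ n, (w - mollifyL2 n w) x = w x - mollify n w x := by
      refine ae_all_iff.2 fun n => ?_
      filter_upwards [Lp.coeFn_sub w (mollifyL2 n w), coeFn_mollifyL2 n w] with x h1 h2
      rw [h1, Pi.sub_apply, h2]
    rw [← integral_zero (RSp d) ℝ (μ := volume)]
    refine tendsto_integral_of_dominated_convergence
      ((Metric.closedBall (0 : RSp d) (R + 1)).indicator
        fun x => (∑ i, ∑ j, |W.toFun x i j|) * (C + C) ^ 2)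
      (fun n => aestronglyMeasurable_matPair W _ _) ?_ (fun n => ?_) ?_
    · rw [integrable_indicator_iff measurableSet_closedBall]
      refine Integrable.mul_const ?_ _
      refine integrable_finsetSum _ fun i _ => integrable_finsetSum _ fun j _ => ?_
      exact ((W.locInt i j).integrableOn_isCompact (isCompact_closedBall _ _)).abs
    · filter_upwards [e, hC, hR] with x hx hC' hR'
      rw [hx]
      by_cases h : x ∈ Metric.closedBall (0 : RSp d) (R + 1)
      · rw [Set.indicator_of_mem h]
        refine abs_matPair_le_sum _ ((norm_sub_le _ _).trans ?_)
        exact add_le_add hC' (norm_mollify_le hC n x)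
      · rw [Set.indicator_of_notMem h]
        rw [mem_closedBall_zero_iff, not_le] at h
        rw [mollify_eq_zero hR n h.le, hR' (by linarith)]
        simp [matPair]
    · filter_upwards [e, mollify_ae_tendsto w] with x hx ht
      simp only [hx]
      have := ((continuous_matPair_self (W.toFun x)).tendsto 0).comp
        (by simpa using ht.const_sub (w x))
      rw [show matPair (W.toFun x) 0 0 = 0 by simp [matPair]] at this
      exact this

/-- Multiplication by a spatial cutoff reduces to compact support. The extra product-rule term is
bounded by a fixed multiple of `‖w x‖` and vanishes at each `x` once `R` is large, so it tends to
zero in `L²`. -/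
theorem mem_formClosure_of_bounded_norm {d m : ℕ} {W : Potential d m} {w : L2 d m}
    (hw : w ∈ formDomain W) {C : ℝ} (hC : ∀ᵐ x, ‖w x‖ ≤ C) : w ∈ formClosure W := by
  obtain ⟨L, hL⟩ := exists_lipschitzWith_cutoff d
  have hfd : ∀ R x (e : RSp d), ‖fderiv ℝ (cutoff d R) x e‖ ≤ L * ‖e‖ := fun R x e =>
    (ContinuousLinearMap.le_opNorm _ _).trans
      (by gcongr; exact norm_fderiv_le_of_lipschitz ℝ (hL R))
  have hcut : ∀ (R : ℕ) (g : L2 d m), MemLp (fun x => cutoff d R x • g x) 2 volume := by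
    intro R g
    refine MemLp.of_le (Lp.memLp g) ?_ (Eventually.of_forall fun x => ?_)
    · exact (contDiff_cutoff d R).continuous.aestronglyMeasurable.smul (Lp.aestronglyMeasurable g)
    · rw [norm_smul, Real.norm_of_nonneg (cutoff_nonneg _ _ _)]
      exact mul_le_of_le_one_left (norm_nonneg _) (cutoff_le_one _ _ _)
  have hder : ∀ (R : ℕ) (k : Fin d), MemLp
      (fun x => fderiv ℝ (cutoff d R) x (EuclideanSpace.single k 1) • w x) 2 volume := by
    intro R k
    refine MemLp.of_le_mul (c := L) (Lp.memLp w) ?_ (Eventually.of_forall fun x => ?_)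
    · exact (((contDiff_cutoff d R).continuous_fderiv (by simp)).clm_apply
        continuous_const).aestronglyMeasurable.smul (Lp.aestronglyMeasurable w)
    · rw [norm_smul]
      gcongr
      simpa using hfd R x (EuclideanSpace.single k 1)
  have hP : ∀ (R : ℕ) (k : Fin d), IsWeakPartial k ((hcut R w).toLp _)
      ((hcut R (weakPartial k w)).toLp _ + (hder R k).toLp _) := by
    intro R k
    refine (isWeakPartial_weakPartial hw k).smul_contDiff (contDiff_cutoff d R)
      (hcut R w).coeFn_toLp ?_
    filter_upwards [Lp.coeFn_add ((hcut R (weakPartial k w)).toLp _) ((hder R k).toLp _),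
      (hcut R (weakPartial k w)).coeFn_toLp, (hder R k).coeFn_toLp] with x h1 h2 h3
    rw [h1, Pi.add_apply, h2, h3]
  have hdom : ∀ R, (hcut R w).toLp _ ∈ formDomain W := by
    refine fun R => ⟨fun k => ⟨_, hP R k⟩, ?_⟩
    refine integrable_matPair_of_scaled W hw.2 (fun x => ?_) (hcut R w).coeFn_toLp
    rw [abs_of_nonneg (cutoff_nonneg _ _ _)]
    exact cutoff_le_one _ _ _
  refine mem_formClosure_of_tendsto (f := fun R => (hcut R w).toLp _) hw (fun R => ?_) ?_
  · refine mem_formClosure_of_bounded (C := C) (R := 2 * ((R : ℝ) + 1)) (hdom R) ?_ ?_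
    · filter_upwards [(hcut R w).coeFn_toLp, hC] with x h1 h2
      rw [h1, norm_smul, Real.norm_of_nonneg (cutoff_nonneg _ _ _)]
      exact (mul_le_of_le_one_left (norm_nonneg _) (cutoff_le_one _ _ _)).trans h2
    · filter_upwards [(hcut R w).coeFn_toLp] with x h1 h2
      rw [h1, cutoff_eq_zero h2, zero_smul]
  · refine tendsto_form_sub hw hdom (fun k => ?_) ?_
    · simp only [(hP _ k).weakPartial_eq]
      have h1 : ∀ᵐ x, ∀ R, (hcut R (weakPartial k w)).toLp _ x = cutoff d R x • weakPartial k w x :=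
        ae_all_iff.2 fun R => (hcut R (weakPartial k w)).coeFn_toLp
      have h2 : ∀ᵐ x, ∀ R, (hder R k).toLp _ x
          = fderiv ℝ (cutoff d R) x (EuclideanSpace.single k 1) • w x :=
        ae_all_iff.2 fun R => (hder R k).coeFn_toLp
      have t1 : Tendsto (fun R => (hcut R (weakPartial k w)).toLp _) atTop
          (𝓝 (weakPartial k w)) := by
        refine tendsto_L2_of_dominated (b := fun x => 2 * ‖weakPartial k w x‖)
          ((Lp.memLp (weakPartial k w)).norm.const_mul _) (fun R => ?_) ?_
        · filter_upwards [h1] with x hx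
          refine (norm_sub_le _ _).trans ?_
          rw [hx, norm_smul, Real.norm_of_nonneg (cutoff_nonneg _ _ _)]
          have := mul_le_of_le_one_left (norm_nonneg (weakPartial k w x)) (cutoff_le_one d R x)
          linarith
        · filter_upwards [h1] with x hx
          simp only [hx]
          simpa using (tendsto_cutoff x).smul_const (weakPartial k w x)
      have t2 : Tendsto (fun R => (hder R k).toLp _) atTop (𝓝 (0 : L2 d m)) := by
        refine tendsto_L2_of_dominated (b := fun x => L * ‖w x‖)
          ((Lp.memLp w).norm.const_mul _) (fun R => ?_) ?_
        · filter_upwards [h2, Lp.coeFn_zero (RSp m) 2 (volume : Measure (RSp d))] with x hx h0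
          rw [hx, h0, Pi.zero_apply, sub_zero, norm_smul]
          gcongr
          simpa using hfd R x (EuclideanSpace.single k 1)
        · filter_upwards [h2, Lp.coeFn_zero (RSp m) 2 (volume : Measure (RSp d))] with x hx h0
          simp only [hx, h0, Pi.zero_apply]
          refine tendsto_const_nhds.congr' ?_
          filter_upwards [cutoff_eventuallyEq_one x] with R hR
          rw [hR.fderiv_eq]
          simp
      simpa using t1.add t2
    · exact tendsto_integral_matPair_of_scaled W hw.2 (fun _ => cutoff_nonneg _ _)
        (fun _ => cutoff_le_one _ _) tendsto_cutoff fun R => (hcut R w).coeFn_toLp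

/-- Test functions are dense in the maximal form domain. -/
theorem formClosure_eq_formDomain {d m : ℕ} (W : Potential d m) : formClosure W = formDomain W := by
  refine le_antisymm (fun _ h => h.1) fun w hw => ?_
  obtain ⟨C, hL⟩ := exists_lipschitzWith_truncId m
  -- The cutoff acts on the values of `w`: at each point the whole vector is rescaled by a number in
  -- `[0, 1]`, which bounds it and does not increase the potential energy density.
  set f : ℕ → L2 d m := fun R => (hL R).compLp (truncId_zero m R) w
  have hf : ∀ R, f R =ᵐ[volume] fun x => cutoff m R (w x) • w x := fun R =>
    (hL R).coeFn_compLp (truncId_zero m R) w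
  have hM : ∀ R k, MemLp (fun x => fderiv ℝ (truncId m R) (w x) (weakPartial k w x)) 2 volume :=
    fun R k => memLp_fderiv_apply (contDiff_truncId m R) (hL R) _ _
  have hP : ∀ R k, IsWeakPartial k (f R) ((hM R k).toLp _) := fun R k =>
    (isWeakPartial_weakPartial hw k).comp (contDiff_truncId m R) (hL R) (truncId_zero m R)
      (hM R k).coeFn_toLp
  have hdom : ∀ R, f R ∈ formDomain W := by
    refine fun R => ⟨fun k => ⟨_, hP R k⟩, ?_⟩
    refine integrable_matPair_of_scaled W hw.2 (fun x => ?_) (hf R)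
    rw [abs_of_nonneg (cutoff_nonneg _ _ _)]
    exact cutoff_le_one _ _ _
  refine mem_formClosure_of_tendsto (f := f) hw (fun R => ?_) ?_
  · refine mem_formClosure_of_bounded_norm (C := 2 * ((R : ℝ) + 1)) (hdom R) ?_
    filter_upwards [hf R] with x hx
    rw [hx]
    exact norm_truncId_le m R (w x)
  · refine tendsto_form_sub hw hdom (fun k => ?_) ?_
    · simp only [(hP _ k).weakPartial_eq]
      have h1 : ∀ᵐ x, ∀ R, (hM R k).toLp _ x
          = fderiv ℝ (truncId m R) (w x) (weakPartial k w x) :=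
        ae_all_iff.2 fun R => (hM R k).coeFn_toLp
      refine tendsto_L2_of_dominated (b := fun x => (C + 1) * ‖weakPartial k w x‖)
        ((Lp.memLp (weakPartial k w)).norm.const_mul _) (fun R => ?_) ?_
      · filter_upwards [h1] with x hx
        refine (norm_sub_le _ _).trans ?_
        rw [hx, add_mul, one_mul]
        gcongr
        exact (ContinuousLinearMap.le_opNorm _ _).trans
          (by gcongr; exact norm_fderiv_le_of_lipschitz ℝ (hL R))
      · filter_upwards [h1] with x hx
        simp only [hx]
        exact tendsto_fderiv_truncId _ _
    · exact tendsto_integral_matPair_of_scaled W hw.2 (fun _ _ => cutoff_nonneg _ _ _)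
        (fun _ _ => cutoff_le_one _ _ _) (fun x => tendsto_cutoff (w x)) hf

/-! ### Completeness of the form domain -/

theorem norm_weakPartial_sq_le {d m : ℕ} {W : Potential d m} {u : L2 d m} (hu : u ∈ formDomain W)
    (k : Fin d) : ‖weakPartial k u‖ ^ 2 ≤ form W u u := by
  rw [form_eq hu hu]
  simp only [real_inner_self_eq_norm_sq]
  have h1 : 0 ≤ ∫ x, matPair (W.toFun x) (u x) (u x) := by
    refine integral_nonneg_of_ae ?_
    filter_upwards [W.nonneg] with x hx using hx _
  have h2 := Finset.single_le_sum (f := fun k : Fin d => ‖weakPartial k u‖ ^ 2)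
    (fun _ _ => sq_nonneg _) (Finset.mem_univ k)
  linarith

theorem integral_matPair_le_form {d m : ℕ} {W : Potential d m} {u : L2 d m}
    (hu : u ∈ formDomain W) : ∫ x, matPair (W.toFun x) (u x) (u x) ≤ form W u u := by
  rw [form_eq hu hu]
  simp only [real_inner_self_eq_norm_sq]
  have : 0 ≤ ∑ k : Fin d, ‖weakPartial k u‖ ^ 2 := Finset.sum_nonneg fun _ _ => sq_nonneg _
  linarith

/-- Fatou's lemma: the quadratic form is nonnegative and continuous in the vector at almost every
point. -/
theorem integral_matPair_le_of_tendsto_ae {d m : ℕ} {W : Potential d m} {v : ℕ → L2 d m}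
    {v₀ : L2 d m} {C : ℝ} (ht : ∀ᵐ x, Tendsto (fun j => v j x) atTop (𝓝 (v₀ x)))
    (hv : ∀ j, v j ∈ formDomain W)
    (hC : ∀ᶠ j in atTop, ∫ x, matPair (W.toFun x) (v j x) (v j x) ≤ C) :
    Integrable (fun x => matPair (W.toFun x) (v₀ x) (v₀ x)) volume ∧
      ∫ x, matPair (W.toFun x) (v₀ x) (v₀ x) ≤ C := by
  have hnn : ∀ u : L2 d m, 0 ≤ᵐ[volume] fun x => matPair (W.toFun x) (u x) (u x) := fun u => by
    filter_upwards [W.nonneg] with x hx using hx _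
  have hC0 : 0 ≤ C := by
    obtain ⟨j, hj⟩ := hC.exists
    exact (integral_nonneg_of_ae (hnn (v j))).trans hj
  have hle : ∫⁻ x, ENNReal.ofReal (matPair (W.toFun x) (v₀ x) (v₀ x)) ≤ ENNReal.ofReal C := by
    have e : ∫⁻ x, ENNReal.ofReal (matPair (W.toFun x) (v₀ x) (v₀ x))
        = ∫⁻ x, liminf (fun j => ENNReal.ofReal (matPair (W.toFun x) (v j x) (v j x))) atTop := by
      refine lintegral_congr_ae ?_
      filter_upwards [ht] with x hx
      refine (Tendsto.liminf_eq ?_).symm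
      exact ENNReal.tendsto_ofReal (((continuous_matPair_self (W.toFun x)).tendsto _).comp hx)
    rw [e]
    refine (lintegral_liminf_le' fun j =>
      (aestronglyMeasurable_matPair W (v j) (v j)).aemeasurable.ennreal_ofReal).trans ?_
    refine liminf_le_of_frequently_le' (Eventually.frequently ?_)
    filter_upwards [hC] with j hj
    rw [← ofReal_integral_eq_lintegral_ofReal (hv j).2 (hnn _)]
    exact ENNReal.ofReal_le_ofReal hj
  have hi : Integrable (fun x => matPair (W.toFun x) (v₀ x) (v₀ x)) volume :=
    ⟨aestronglyMeasurable_matPair W _ _,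
      (hasFiniteIntegral_iff_ofReal (hnn _)).2 (hle.trans_lt ENNReal.ofReal_lt_top)⟩
  refine ⟨hi, ?_⟩
  rwa [← ofReal_integral_eq_lintegral_ofReal hi (hnn _), ENNReal.ofReal_le_ofReal_iff hC0] at hle

/-- The form of `W` is bounded below by `ε` times the square of the `L²` norm. -/
def Coercive {d m : ℕ} (W : Potential d m) (ε : ℝ) : Prop :=
  ∀ u ∈ formDomain W, ε * ‖u‖ ^ 2 ≤ form W u u

theorem cauchySeq_of_form {d m : ℕ} {W : Potential d m} {u v : ℕ → L2 d m} {c : ℝ} (hc : 0 < c)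
    (hu : ∀ δ > 0, ∃ N, ∀ p ≥ N, ∀ q ≥ N, form W (u p - u q) (u p - u q) < δ)
    (h : ∀ p q, c * ‖v p - v q‖ ^ 2 ≤ form W (u p - u q) (u p - u q)) : CauchySeq v := by
  rw [Metric.cauchySeq_iff]
  intro δ hδ
  obtain ⟨N, hN⟩ := hu (c * δ ^ 2) (by positivity)
  refine ⟨N, fun p hp q hq => ?_⟩
  have := (h p q).trans_lt (hN p hp q hq)
  rw [dist_eq_norm]
  exact lt_of_pow_lt_pow_left₀ 2 hδ.le ((mul_lt_mul_iff_right₀ hc).1 this)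

theorem formDomain_complete {d m : ℕ} {W : Potential d m} {ε : ℝ} (hε : 0 < ε)
    (hW : Coercive W ε) {u : ℕ → L2 d m} (hu : ∀ n, u n ∈ formDomain W)
    (hC : ∀ δ > 0, ∃ N, ∀ p ≥ N, ∀ q ≥ N, form W (u p - u q) (u p - u q) < δ) :
    ∃ l ∈ formDomain W, Tendsto (fun n => form W (l - u n) (l - u n)) atTop (𝓝 0) := by
  have hd : ∀ p q, u p - u q ∈ formDomain W := fun p q => (formDomain W).sub_mem (hu p) (hu q)
  obtain ⟨l, hl⟩ := cauchySeq_tendsto_of_complete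
    (cauchySeq_of_form hε hC fun p q => hW _ (hd p q))
  have hg : ∀ k, ∃ g, Tendsto (fun n => weakPartial k (u n)) atTop (𝓝 g) := fun k =>
    cauchySeq_tendsto_of_complete (cauchySeq_of_form one_pos hC fun p q => by
      rw [one_mul, ← weakPartial_sub k (hu p) (hu q)]
      exact norm_weakPartial_sq_le (hd p q) k)
  choose g hg using hg
  have hw : ∀ k, IsWeakPartial k l (g k) := fun k =>
    IsWeakPartial.of_tendsto (Eventually.of_forall fun n => isWeakPartial_weakPartial (hu n) k)
      hl (hg k)
  -- Fatou needs pointwise convergence, available along a subsequence only; in `key` it is applied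
  -- to `u (ns j) - u n` as `j → ∞` with `n` fixed.
  obtain ⟨ns, hns, hae⟩ := (tendstoInMeasure_of_tendsto_Lp hl).exists_seq_tendsto_ae
  have key : ∀ δ > 0, ∃ N, ∀ n ≥ N,
      Integrable (fun x => matPair (W.toFun x) ((l - u n) x) ((l - u n) x)) volume ∧
        ∫ x, matPair (W.toFun x) ((l - u n) x) ((l - u n) x) ≤ δ := by
    intro δ hδ
    obtain ⟨N, hN⟩ := hC δ hδ
    refine ⟨N, fun n hn => ?_⟩
    refine integral_matPair_le_of_tendsto_ae (v := fun j => u (ns j) - u n) ?_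
      (fun j => hd _ _) ?_
    · have h1 : ∀ᵐ x, ∀ j, (u (ns j) - u n) x = u (ns j) x - u n x :=
        ae_all_iff.2 fun j => Lp.coeFn_sub _ _
      filter_upwards [hae, h1, Lp.coeFn_sub l (u n)] with x h2 h1 h3
      simp only [h1, h3, Pi.sub_apply]
      exact h2.sub_const _
    · filter_upwards [eventually_ge_atTop N] with j hj
      exact (integral_matPair_le_form (hd _ _)).trans
        (hN _ (hj.trans (hns.id_le j)) _ hn).le
  have hl' : l ∈ formDomain W := by
    obtain ⟨N, hN⟩ := key 1 one_pos
    have h : l - u N ∈ formDomain W := by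
      refine ⟨fun k => ?_, (hN N le_rfl).1⟩
      refine ⟨g k + (-1 : ℝ) • weakPartial k (u N), ?_⟩
      rw [sub_eq_add_neg, ← neg_one_smul ℝ (u N)]
      exact (hw k).add ((isWeakPartial_weakPartial (hu N) k).smul _)
    simpa using (formDomain W).add_mem h (hu N)
  refine ⟨l, hl', tendsto_form_sub hl' hu (fun k => ?_) ?_⟩
  · rw [(hw k).weakPartial_eq]
    exact hg k
  · rw [Metric.tendsto_atTop]
    intro δ hδ
    obtain ⟨N, hN⟩ := key (δ / 2) (by positivity)
    refine ⟨N, fun n hn => ?_⟩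
    rw [Real.dist_eq, sub_zero, abs_of_nonneg]
    · linarith [(hN n hn).2]
    · refine integral_nonneg_of_ae ?_
      filter_upwards [W.nonneg] with x hx using hx _

/-! ### Solvability -/

/-- The Riesz representation theorem for a complete inner product given as a bilinear form. -/
theorem exists_representative_of_complete {E : Type*} [AddCommGroup E] [Module ℝ E]
    (B : E →ₗ[ℝ] E →ₗ[ℝ] ℝ) (hs : ∀ u v, B u v = B v u) (hp : ∀ u, 0 ≤ B u u)
    (hd : ∀ u, B u u = 0 → u = 0)
    (hc : ∀ u : ℕ → E, (∀ δ > 0, ∃ N, ∀ p ≥ N, ∀ q ≥ N, B (u p - u q) (u p - u q) < δ) →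
      ∃ l, Tendsto (fun n => B (l - u n) (l - u n)) atTop (𝓝 0))
    (L : E →ₗ[ℝ] ℝ) (C : ℝ) (hL : ∀ v, |L v| ≤ C * Real.sqrt (B v v)) :
    ∃ u, ∀ v, B u v = L v := by
  -- `E` itself becomes a Hilbert space with inner product `B`; `hc` is exactly its completeness,
  -- and `L` is bounded for its norm.
  let core : InnerProductSpace.Core ℝ E :=
    { inner := fun u v => B u v
      conj_inner_symm := fun u v => hs v u
      re_inner_nonneg := hp
      add_left := fun u v w => by simp
      smul_left := fun u v r => by simp
      definite := hd }
  let : NormedAddCommGroup E := core.toNormedAddCommGroup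
  let : InnerProductSpace ℝ E := InnerProductSpace.ofCore core.toCore
  have hi : ∀ u v : E, inner ℝ u v = B u v := fun _ _ => rfl
  have hn : ∀ u : E, ‖u‖ = Real.sqrt (B u u) := fun _ => rfl
  have : CompleteSpace E := by
    refine Metric.complete_of_cauchySeq_tendsto fun u hu => ?_
    obtain ⟨l, hl⟩ := hc u fun δ hδ => by
      obtain ⟨N, hN⟩ := Metric.cauchySeq_iff.1 hu (Real.sqrt δ) (Real.sqrt_pos.2 hδ)
      refine ⟨N, fun p hp' q hq => ?_⟩
      have := hN p hp' q hq
      rwa [dist_eq_norm, hn, Real.sqrt_lt_sqrt_iff (hp _)] at this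
    refine ⟨l, tendsto_iff_norm_sub_tendsto_zero.2 ?_⟩
    have := (Real.continuous_sqrt.tendsto 0).comp hl
    rw [Real.sqrt_zero] at this
    refine this.congr fun n => ?_
    rw [norm_sub_rev, hn]
    rfl
  let L' : StrongDual ℝ E := L.mkContinuous C fun v => by
    rw [Real.norm_eq_abs, hn]
    exact hL v
  refine ⟨(InnerProductSpace.toDual ℝ E).symm L', fun v => ?_⟩
  rw [← hi, InnerProductSpace.toDual_symm_apply]
  rfl

/-- The form as a bilinear map on the form domain. -/
noncomputable def formBilin {d m : ℕ} (W : Potential d m) :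
    formDomain W →ₗ[ℝ] formDomain W →ₗ[ℝ] ℝ :=
  LinearMap.mk₂ ℝ (fun u v => form W u v)
    (fun u v w => form_add_left W u.2 v.2 w.2)
    (fun c u v => form_smul_left W c u.2)
    (fun u v w => by
      rw [form_comm, form_comm W u v, form_comm W u w]
      exact form_add_left W v.2 w.2 u.2)
    (fun c u v => by
      rw [form_comm, form_comm W u v]
      exact form_smul_left W c v.2)

theorem Coercive.eq_zero {d m : ℕ} {W : Potential d m} {ε : ℝ} (hε : 0 < ε) (hW : Coercive W ε)
    {u : L2 d m} (hu : u ∈ formDomain W) (h : form W u u ≤ 0) : u = 0 := by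
  have h1 := (hW u hu).trans h
  have h2 : ‖u‖ ^ 2 ≤ 0 := nonpos_of_mul_nonpos_right h1 hε
  exact norm_eq_zero.1 (pow_eq_zero_iff two_ne_zero |>.1 (le_antisymm h2 (sq_nonneg _)))

/-- `u` is the weak solution of `H u = f`, where `H` is associated with the form of `W`. -/
def IsSolution {d m : ℕ} (W : Potential d m) (f u : L2 d m) : Prop :=
  u ∈ formDomain W ∧ ∀ φ ∈ formDomain W, form W u φ = inner ℝ f φ

/-- Riesz representation in the form domain: coercivity bounds `⟨f, ·⟩` by `‖f‖ / √ε` times the form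
norm. -/
theorem Coercive.exists_isSolution {d m : ℕ} {W : Potential d m} {ε : ℝ} (hε : 0 < ε)
    (hW : Coercive W ε) (f : L2 d m) : ∃ u, IsSolution W f u := by
  obtain ⟨u, hu⟩ := exists_representative_of_complete (formBilin W)
    (fun u v => form_comm W u v) (fun u => form_nonneg W u)
    (fun u hu => Subtype.ext (hW.eq_zero hε u.2 hu.le))
    (fun u hu => by
      obtain ⟨l, hl, hl'⟩ := formDomain_complete hε hW (fun n => (u n).2) hu
      exact ⟨⟨l, hl⟩, hl'⟩)
    ((innerₗ (L2 d m) f).comp (formDomain W).subtype) (‖f‖ / Real.sqrt ε)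
    (fun v => by
      have h1 : |inner ℝ f (v : L2 d m)| ≤ ‖f‖ * ‖(v : L2 d m)‖ := abs_real_inner_le_norm _ _
      have h2 : ‖(v : L2 d m)‖ ≤ Real.sqrt (form W v v) / Real.sqrt ε := by
        rw [← Real.sqrt_div' _ hε.le]
        refine Real.le_sqrt_of_sq_le ?_
        rw [le_div_iff₀ hε, mul_comm]
        exact hW v v.2
      refine h1.trans ?_
      rw [div_mul_eq_mul_div, mul_div_assoc]
      exact mul_le_mul_of_nonneg_left h2 (norm_nonneg _))
  exact ⟨u, u.2, fun φ hφ => hu ⟨φ, hφ⟩⟩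

theorem form_sub_left {d m : ℕ} {W : Potential d m} {f g h : L2 d m} (hf : f ∈ formDomain W)
    (hg : g ∈ formDomain W) (hh : h ∈ formDomain W) :
    form W (f - g) h = form W f h - form W g h := by
  rw [sub_eq_add_neg, ← neg_one_smul ℝ g, form_add_left W hf ((formDomain W).smul_mem _ hg) hh,
    form_smul_left W _ hg]
  ring

theorem Coercive.isSolution_unique {d m : ℕ} {W : Potential d m} {ε : ℝ} (hε : 0 < ε)
    (hW : Coercive W ε) {f u v : L2 d m} (hu : IsSolution W f u) (hv : IsSolution W f v) :
    u = v := by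
  have hd := (formDomain W).sub_mem hu.1 hv.1
  refine sub_eq_zero.1 (hW.eq_zero hε hd ?_)
  rw [form_sub_left hu.1 hv.1 hd, hu.2 _ hd, hv.2 _ hd, sub_self]

theorem IsSolution.sub {d m : ℕ} {W : Potential d m} {f g u v : L2 d m} (hu : IsSolution W f u)
    (hv : IsSolution W g v) : IsSolution W (f - g) (u - v) :=
  ⟨(formDomain W).sub_mem hu.1 hv.1, fun φ hφ => by
    rw [form_sub_left hu.1 hv.1 hφ, hu.2 φ hφ, hv.2 φ hφ, inner_sub_left]⟩

/-! ### Positivity and comparison -/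

theorem matPair_sub_sub {m : ℕ} {A : Matrix (Fin m) (Fin m) ℝ} (hA : ∀ i j, A i j = A j i)
    (ξ η : RSp m) :
    matPair A (ξ - η) (ξ - η) = matPair A ξ ξ - 2 * matPair A ξ η + matPair A η η := by
  have e : ∀ ζ, matPair A (ξ - η) ζ = matPair A ξ ζ - matPair A η ζ := fun ζ => by
    rw [sub_eq_add_neg, ← neg_one_smul ℝ η, matPair_add_left, matPair_smul_left]
    ring
  rw [e, matPair_comm hA ξ, matPair_comm hA η (ξ - η), e, e, matPair_comm hA η ξ]
  ring

/-- Termwise: on the diagonal `η_i² = ξ_i η_i`, while off the diagonal `ξ_j η_i ≤ η_j η_i` is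
multiplied by a nonpositive entry. -/
theorem matPair_pos_le {m : ℕ} {A : Matrix (Fin m) (Fin m) ℝ} (ho : ∀ i j, i ≠ j → A i j ≤ 0)
    {ξ η : RSp m} (h : ∀ i, η i = max (ξ i) 0) : matPair A η η ≤ matPair A ξ η := by
  refine Finset.sum_le_sum fun i _ => Finset.sum_le_sum fun j _ => ?_
  rw [mul_assoc, mul_assoc]
  by_cases hij : i = j
  · subst hij
    have : η i * η i = ξ i * η i := by
      rw [h]
      rcases le_total (ξ i) 0 with h0 | h0
      · rw [max_eq_right h0]; simp
      · rw [max_eq_left h0]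
    rw [this]
  · have h1 : ξ j ≤ η j := (h j).symm ▸ le_max_left _ _
    have h2 : 0 ≤ η i := (h i).symm ▸ le_max_right _ _
    exact mul_le_mul_of_nonpos_left (mul_le_mul_of_nonneg_right h1 h2) (ho i j hij)

/-- Combines `A(η, η) ≤ A(ξ, η)` with `2 A(ξ, η) ≤ A(ξ, ξ) + A(η, η)`. It keeps positive parts
inside the form domain. -/
theorem matPair_pos_self_le {m : ℕ} {A : Matrix (Fin m) (Fin m) ℝ} (hA : ∀ i j, A i j = A j i)
    (ho : ∀ i j, i ≠ j → A i j ≤ 0) (hp : ∀ ξ : RSp m, 0 ≤ matPair A ξ ξ)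
    {ξ η : RSp m} (h : ∀ i, η i = max (ξ i) 0) : matPair A η η ≤ matPair A ξ ξ := by
  have h1 := matPair_pos_le ho h
  have h2 := hp (ξ - η)
  rw [matPair_sub_sub hA] at h2
  linarith

theorem posPart_mem_formDomain {d m : ℕ} {W : Potential d m} {u : L2 d m}
    (hu : u ∈ formDomain W) : posPart u ∈ formDomain W := by
  refine ⟨fun k => ?_, ?_⟩
  · obtain ⟨G, hG, -⟩ := (isWeakPartial_weakPartial hu k).posPart
    exact ⟨G, hG⟩
  · refine hu.2.mono' (aestronglyMeasurable_matPair W _ _) ?_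
    filter_upwards [W.symm, W.offDiag, W.nonneg, coeFn_posPart u] with x hs ho hp h
    rw [Real.norm_of_nonneg (hp _)]
    exact matPair_pos_self_le hs ho hp h

/-- In the gradient term the slope `p` of the positive part lies in `[0, 1]`, so `p² ≤ p`; the
potential term is `matPair_pos_le`. This inequality carries the whole order theory. -/
theorem form_posPart_le {d m : ℕ} {W : Potential d m} {u : L2 d m} (hu : u ∈ formDomain W) :
    form W (posPart u) (posPart u) ≤ form W u (posPart u) := by
  have hp := posPart_mem_formDomain hu
  refine integral_mono_ae (integrable_formDensity W hp hp) (integrable_formDensity W hu hp) ?_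
  have hw : ∀ᵐ x, ∀ k : Fin d, ∀ i,
      weakPartial k (posPart u) x i = posSlope (u x i) * weakPartial k u x i := by
    refine ae_all_iff.2 fun k => ?_
    obtain ⟨G, hG, hG'⟩ := (isWeakPartial_weakPartial hu k).posPart
    rwa [hG.weakPartial_eq]
  filter_upwards [W.offDiag, coeFn_posPart u, hw] with x ho h hw
  refine add_le_add (Finset.sum_le_sum fun i _ => Finset.sum_le_sum fun k _ => ?_)
    (matPair_pos_le ho h)
  rw [hw]
  have h0 := posSlope_nonneg (u x i)
  have h1 := posSlope_le_one (u x i)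
  have h2 : posSlope (u x i) * posSlope (u x i) ≤ posSlope (u x i) :=
    mul_le_of_le_one_left h0 h1
  have h3 := mul_le_mul_of_nonneg_right h2 (mul_self_nonneg (weakPartial k u x i))
  linarith

theorem compLE_zero_iff {d m : ℕ} {f : L2 d m} : CompLE 0 f ↔ ∀ᵐ x, ∀ i, 0 ≤ f x i := by
  refine eventually_congr (Eventually.of_forall fun x => ?_)
  simp

theorem compLE_zero_posPart {d m : ℕ} (u : L2 d m) : CompLE 0 (posPart u) := by
  rw [compLE_zero_iff]
  filter_upwards [coeFn_posPart u] with x hx i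
  rw [hx]
  exact le_max_right _ _

theorem inner_nonneg_of_compLE {d m : ℕ} {f g : L2 d m} (hf : CompLE 0 f) (hg : CompLE 0 g) :
    0 ≤ inner ℝ f g := by
  rw [compLE_zero_iff] at hf hg
  rw [inner_eq_integral_sum]
  refine integral_nonneg_of_ae ?_
  filter_upwards [hf, hg] with x h1 h2
  exact Finset.sum_nonneg fun i _ => mul_nonneg (h1 i) (h2 i)

/-- With `φ = (u - v)⁺`, the hypothesis gives `a(φ, φ) ≤ a(u - v, φ) ≤ 0`, and coercivity forces `φ
= 0`. -/
theorem compLE_of_form_posPart_nonpos {d m : ℕ} {W : Potential d m} {ε : ℝ} (hε : 0 < ε)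
    (hW : Coercive W ε) {u v : L2 d m} (hu : u ∈ formDomain W) (hv : v ∈ formDomain W)
    (h : form W (u - v) (posPart (u - v)) ≤ 0) : CompLE u v := by
  have hd := (formDomain W).sub_mem hu hv
  have h0 := hW.eq_zero hε (posPart_mem_formDomain hd) ((form_posPart_le hd).trans h)
  have h1 := coeFn_posPart (u - v)
  rw [h0] at h1
  filter_upwards [h1, Lp.coeFn_zero (RSp m) 2 (volume : Measure (RSp d)), Lp.coeFn_sub u v]
    with x h1 h2 h3 i
  have := h1 i
  rw [h2, h3] at this
  simp only [Pi.zero_apply, Pi.sub_apply, PiLp.zero_apply, PiLp.sub_apply] at this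
  have h4 : u x i - v x i ≤ 0 := this.symm ▸ le_max_left _ _
  linarith

/-- Testing with `φ = (-u)⁺` gives `a(-u, φ) = -⟨f, φ⟩ ≤ 0`. -/
theorem IsSolution.nonneg {d m : ℕ} {W : Potential d m} {ε : ℝ} (hε : 0 < ε)
    (hW : Coercive W ε) {f u : L2 d m} (hu : IsSolution W f u) (hf : CompLE 0 f) :
    CompLE 0 u := by
  have h0 := (formDomain W).zero_mem
  have hp := posPart_mem_formDomain ((formDomain W).sub_mem h0 hu.1)
  refine compLE_of_form_posPart_nonpos hε hW h0 hu.1 ?_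
  have hz : form W 0 (posPart (0 - u)) = 0 := by
    have := form_smul_left W 0 (h := posPart (0 - u)) h0
    rwa [zero_smul, zero_mul] at this
  rw [form_sub_left h0 hu.1 hp, hu.2 _ hp, hz]
  linarith [inner_nonneg_of_compLE hf (compLE_zero_posPart (0 - u))]

theorem form_le_form_of_entrywise {d m : ℕ} {W W' : Potential d m}
    (h : ∀ᵐ x, ∀ i j, W'.toFun x i j ≤ W.toFun x i j) {u v : L2 d m} (hu : u ∈ formDomain W)
    (hu' : u ∈ formDomain W') (hv : v ∈ formDomain W) (hv' : v ∈ formDomain W')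
    (h0 : CompLE 0 u) (h1 : CompLE 0 v) : form W' u v ≤ form W u v := by
  rw [compLE_zero_iff] at h0 h1
  refine integral_mono_ae (integrable_formDensity W' hu' hv') (integrable_formDensity W hu hv) ?_
  filter_upwards [h, h0, h1] with x h h0 h1
  refine add_le_add le_rfl (Finset.sum_le_sum fun i _ => Finset.sum_le_sum fun j _ => ?_)
  rw [mul_assoc, mul_assoc]
  exact mul_le_mul_of_nonneg_right (h i j) (mul_nonneg (h0 j) (h1 i))

/-- With `φ = (u - u')⁺`, `a_W(u - u', φ) = ⟨f, φ⟩ - a_W(u', φ) ≤ ⟨f, φ⟩ - a_{W'}(u', φ) = 0`. The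
inequality uses `u' ≥ 0`; equality of the domains makes `u'` and `φ` admissible for both forms. -/
theorem IsSolution.compLE {d m : ℕ} {W W' : Potential d m} {ε ε' : ℝ} (hε : 0 < ε)
    (hW : Coercive W ε) (hε' : 0 < ε') (hW' : Coercive W' ε')
    (h : ∀ᵐ x, ∀ i j, W'.toFun x i j ≤ W.toFun x i j) (hd : formDomain W = formDomain W')
    {f u u' : L2 d m} (hf : CompLE 0 f) (hu : IsSolution W f u) (hu' : IsSolution W' f u') :
    CompLE u u' := by
  have h' : u' ∈ formDomain W := hd ▸ hu'.1
  have hp := posPart_mem_formDomain ((formDomain W).sub_mem hu.1 h')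
  have hp' : posPart (u - u') ∈ formDomain W' := hd ▸ hp
  refine compLE_of_form_posPart_nonpos hε hW hu.1 h' ?_
  rw [form_sub_left hu.1 h' hp, hu.2 _ hp, ← hu'.2 _ hp']
  linarith [form_le_form_of_entrywise h h' hu'.1 hp hp' (hu'.nonneg hε' hW' hf)
    (compLE_zero_posPart (u - u'))]

/-! ### The potentials `V + ε` and `V_{ε,M}` -/

theorem sum_sq_eq_norm_sq {m : ℕ} (ξ : RSp m) : ∑ i, ξ i ^ 2 = ‖ξ‖ ^ 2 := by
  rw [EuclideanSpace.norm_sq_eq]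
  simp

theorem integrable_norm_sq {d m : ℕ} (f : L2 d m) :
    Integrable (fun x => ‖f x‖ ^ 2) volume :=
  (Lp.memLp f).integrable_norm_pow two_ne_zero

theorem coercive_of_le {d m : ℕ} {W : Potential d m} {ε : ℝ}
    (h : ∀ᵐ x, ∀ ξ : RSp m, ε * ‖ξ‖ ^ 2 ≤ matPair (W.toFun x) ξ ξ) : Coercive W ε := by
  intro u hu
  refine le_trans ?_ (integral_matPair_le_form hu)
  rw [← real_inner_self_eq_norm_sq, inner_eq_integral_sum, ← integral_const_mul]
  refine integral_mono_ae ((integrable_sum_mul u u).const_mul _) hu.2 ?_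
  filter_upwards [h] with x hx
  have := hx (u x)
  rw [← sum_sq_eq_norm_sq] at this
  simpa only [sq] using this

theorem coercive_shift {d m : ℕ} (V : Potential d m) {ε : ℝ} (hε : 0 < ε) :
    Coercive (V.shift ε hε) ε := by
  refine coercive_of_le ?_
  filter_upwards [V.nonneg] with x hp ξ
  simp only [Potential.shift]
  rw [matPair_add_smul_one, sum_sq_eq_norm_sq]
  linarith [hp ξ]

/-- Half of `ε` is kept in the truncated matrix, which is still nonnegative definite by
`truncMatrix_nonneg`; the other half gives the lower bound. -/
theorem coercive_trunc {d m : ℕ} (V : Potential d m) {ε : ℝ} (hε : 0 < ε) (M : ℕ) :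
    Coercive (V.trunc ε hε M) (ε / 2) := by
  refine coercive_of_le ?_
  filter_upwards [V.offDiag, V.nonneg] with x ho hp ξ
  have e : truncMatrix (V.toFun x) ε M
      = truncMatrix (V.toFun x) (ε / 2) M + (ε / 2) • (1 : Matrix (Fin m) (Fin m) ℝ) := by
    ext i j
    simp only [truncMatrix, Matrix.add_apply, Matrix.smul_apply, Matrix.one_apply, smul_eq_mul]
    split_ifs <;> ring
  simp only [Potential.trunc]
  rw [e, matPair_add_smul_one, sum_sq_eq_norm_sq]
  linarith [truncMatrix_nonneg (half_pos hε) M ho hp ξ]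

theorem matPair_add_smul_one' {m : ℕ} (A : Matrix (Fin m) (Fin m) ℝ) (c : ℝ) (ξ η : RSp m) :
    matPair (A + c • (1 : Matrix (Fin m) (Fin m) ℝ)) ξ η
      = matPair A ξ η + c * ∑ i, ξ i * η i := by
  simp only [matPair, Finset.mul_sum, ← Finset.sum_add_distrib]
  refine Finset.sum_congr rfl fun i _ => ?_
  simp only [Matrix.add_apply, Matrix.smul_apply, smul_eq_mul, add_mul, Finset.sum_add_distrib,
    Matrix.one_apply]
  congr 1
  simp [mul_assoc]

theorem formDomain_shift {d m : ℕ} (V : Potential d m) {ε : ℝ} (hε : 0 < ε) :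
    formDomain (V.shift ε hε) = formDomain V := by
  ext f
  refine and_congr_right fun _ => ?_
  have e : (fun x => matPair ((V.shift ε hε).toFun x) (f x) (f x))
      = fun x => matPair (V.toFun x) (f x) (f x) + ε * ∑ i, f x i * f x i :=
    funext fun x => matPair_add_smul_one' _ _ _ _
  have hi := (integrable_sum_mul f f).const_mul ε
  rw [e]
  refine ⟨fun h => ?_, fun h => h.add hi⟩
  refine (h.sub hi).congr (Eventually.of_forall fun x => ?_)
  simp

theorem form_shift {d m : ℕ} {V : Potential d m} {ε : ℝ} (hε : 0 < ε) {f g : L2 d m}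
    (hf : f ∈ formDomain V) (hg : g ∈ formDomain V) :
    form (V.shift ε hε) f g = form V f g + ε * inner ℝ f g := by
  rw [inner_eq_integral_sum, ← integral_const_mul, form, form,
    ← integral_add (integrable_formDensity V hf hg) ((integrable_sum_mul f g).const_mul ε)]
  refine integral_congr_ae (Eventually.of_forall fun x => ?_)
  simp only [formDensity, Potential.shift, matPair_add_smul_one', add_assoc]

/-! ### Control by the diagonal entries and comparison of the form domains. -/

theorem abs_entry_mul_le {m : ℕ} {A : Matrix (Fin m) (Fin m) ℝ} (hA : ∀ i j, A i j = A j i)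
    (hp : ∀ ξ : RSp m, 0 ≤ matPair A ξ ξ) (ξ : RSp m) (i j : Fin m) :
    |A i j| * |ξ j * ξ i| ≤ A i i * ξ i ^ 2 + A j j * ξ j ^ 2 := by
  have e : ∀ (i j : Fin m) (s t : ℝ),
      matPair A (EuclideanSpace.single j s) (EuclideanSpace.single i t) = A i j * s * t := by
    intro i j s t
    simp [matPair]
  have h := abs_matPair_le hA hp (EuclideanSpace.single j (ξ j)) (EuclideanSpace.single i (ξ i))
  rw [e, e, e] at h
  rw [← abs_mul, ← mul_assoc]
  linarith

theorem diag_nonneg {m : ℕ} {A : Matrix (Fin m) (Fin m) ℝ}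
    (hp : ∀ ξ : RSp m, 0 ≤ matPair A ξ ξ) (i : Fin m) : 0 ≤ A i i := by
  simpa [matPair] using hp (EuclideanSpace.single i 1)

/-- A common pointwise bound for the forms of `V + ε` and `V_{ε,M}`. -/
noncomputable def diagBound {m : ℕ} (A : Matrix (Fin m) (Fin m) ℝ) (ε : ℝ) (ξ : RSp m) : ℝ :=
  ∑ i, ∑ j, (A i i * ξ i ^ 2 + A j j * ξ j ^ 2 + ε * ‖ξ‖ ^ 2)

/-- Nonnegativity of `A` controls its off-diagonal terms by diagonal ones, and the excess `ε` of `U`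
is absorbed by `‖ξ‖²`. The bound does not involve `M`, so it also serves as dominating function. -/
theorem abs_matPair_le_diagBound {m : ℕ} {A U : Matrix (Fin m) (Fin m) ℝ} {ε : ℝ}
    (hA : ∀ i j, A i j = A j i) (hp : ∀ ξ : RSp m, 0 ≤ matPair A ξ ξ) (hε : 0 ≤ ε)
    (h : ∀ i j, |U i j| ≤ |A i j| + ε) (ξ : RSp m) : |matPair U ξ ξ| ≤ diagBound A ε ξ := by
  refine (Finset.abs_sum_le_sum_abs _ _).trans (Finset.sum_le_sum fun i _ => ?_)
  refine (Finset.abs_sum_le_sum_abs _ _).trans (Finset.sum_le_sum fun j _ => ?_)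
  rw [mul_assoc, abs_mul]
  have h1 : |ξ j * ξ i| ≤ ‖ξ‖ ^ 2 := by
    rw [abs_mul, sq]
    exact mul_le_mul (abs_coord_le ξ j) (abs_coord_le ξ i) (abs_nonneg _) (norm_nonneg _)
  calc |U i j| * |ξ j * ξ i| ≤ (|A i j| + ε) * |ξ j * ξ i| := by gcongr; exact h i j
    _ = |A i j| * |ξ j * ξ i| + ε * |ξ j * ξ i| := add_mul _ _ _
    _ ≤ _ := add_le_add (abs_entry_mul_le hA hp ξ i j) (by gcongr)

theorem abs_truncMatrix_le {m : ℕ} {A : Matrix (Fin m) (Fin m) ℝ} {ε : ℝ} (hε : 0 ≤ ε) (M : ℕ)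
    (ho : ∀ i j, i ≠ j → A i j ≤ 0) (i j : Fin m) :
    |truncMatrix A ε M i j| ≤ |A i j| + ε := by
  unfold truncMatrix
  split_ifs with h
  · exact (abs_add_le _ _).trans (by rw [abs_of_nonneg hε])
  · have h1 : max (A i j) (-(M : ℝ)) ≤ 0 := max_le (ho i j h) (by simp)
    rw [abs_of_nonpos h1, abs_of_nonpos (ho i j h)]
    linarith [le_max_left (A i j) (-(M : ℝ))]

theorem abs_shift_le {m : ℕ} (A : Matrix (Fin m) (Fin m) ℝ) {ε : ℝ} (hε : 0 ≤ ε) (i j : Fin m) :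
    |(A + ε • (1 : Matrix (Fin m) (Fin m) ℝ)) i j| ≤ |A i j| + ε := by
  rw [Matrix.add_apply, Matrix.smul_apply, Matrix.one_apply]
  refine (abs_add_le _ _).trans ?_
  gcongr
  split_ifs
  · simp [abs_of_nonneg hε]
  · simpa using hε

/-- Truncated off-diagonal entries have modulus at most `M`, so removing them costs at most `M ‖ξ‖²`
per entry. Finite truncated energy therefore makes each diagonal term integrable. -/
theorem sum_diag_le_matPair_truncMatrix {m : ℕ} (A : Matrix (Fin m) (Fin m) ℝ) {ε : ℝ}
    (hε : 0 ≤ ε) (M : ℕ) (ho : ∀ i j, i ≠ j → A i j ≤ 0) (ξ : RSp m) :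
    ∑ i, A i i * ξ i ^ 2
      ≤ matPair (truncMatrix A ε M) ξ ξ + ∑ _i : Fin m, ∑ _j : Fin m, (M : ℝ) * ‖ξ‖ ^ 2 := by
  simp only [matPair, ← Finset.sum_add_distrib]
  refine Finset.sum_le_sum fun i _ => ?_
  have hb : ∀ j, (if i = j then A i i * ξ i ^ 2 else 0)
      ≤ truncMatrix A ε M i j * ξ j * ξ i + M * ‖ξ‖ ^ 2 := by
    intro j
    have h1 : |ξ j * ξ i| ≤ ‖ξ‖ ^ 2 := by
      rw [abs_mul, sq]
      exact mul_le_mul (abs_coord_le ξ j) (abs_coord_le ξ i) (abs_nonneg _) (norm_nonneg _)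
    have hM : (0 : ℝ) ≤ M := M.cast_nonneg
    unfold truncMatrix
    split_ifs with h
    · subst h
      have h2 : 0 ≤ ε * ξ i ^ 2 := mul_nonneg hε (sq_nonneg _)
      have h3 : 0 ≤ (M : ℝ) * ‖ξ‖ ^ 2 := by positivity
      nlinarith
    · have h2 : |max (A i j) (-(M : ℝ))| ≤ M := by
        rw [abs_of_nonpos (max_le (ho i j h) (by simp))]
        linarith [le_max_right (A i j) (-(M : ℝ))]
      have h3 : |max (A i j) (-(M : ℝ)) * (ξ j * ξ i)| ≤ M * ‖ξ‖ ^ 2 := by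
        rw [abs_mul]
        gcongr
      rw [mul_assoc]
      linarith [(abs_le.1 h3).1]
  calc A i i * ξ i ^ 2 = ∑ j, if i = j then A i i * ξ i ^ 2 else 0 := by simp
    _ ≤ _ := Finset.sum_le_sum fun j _ => hb j

theorem integrable_diag_of_mem_trunc {d m : ℕ} {V : Potential d m} {ε : ℝ} {hε : 0 < ε} {M : ℕ}
    {f : L2 d m} (hf : f ∈ formDomain (V.trunc ε hε M)) (i : Fin m) :
    Integrable (fun x => V.toFun x i i * f x i ^ 2) volume := by
  have hs : Integrable (fun x => ∑ _i : Fin m, ∑ _j : Fin m, (M : ℝ) * ‖f x‖ ^ 2) volume :=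
    integrable_finsetSum _ fun i _ => integrable_finsetSum _ fun j _ =>
      (integrable_norm_sq f).const_mul _
  refine (hf.2.add hs).mono' ?_ ?_
  · have hc : AEStronglyMeasurable (fun x => f x i) volume :=
      (EuclideanSpace.proj (𝕜 := ℝ) i).continuous.comp_aestronglyMeasurable
        (Lp.aestronglyMeasurable f)
    exact (V.locInt i i).aestronglyMeasurable.mul (hc.pow 2)
  · filter_upwards [V.offDiag, V.nonneg] with x ho hp
    have h0 : ∀ i, 0 ≤ V.toFun x i i * f x i ^ 2 := fun i =>
      mul_nonneg (diag_nonneg hp i) (sq_nonneg _)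
    rw [Real.norm_of_nonneg (h0 i)]
    exact (Finset.single_le_sum (f := fun i => V.toFun x i i * f x i ^ 2) (fun i _ => h0 i)
      (Finset.mem_univ i)).trans (sum_diag_le_matPair_truncMatrix _ hε.le M ho (f x))

theorem integrable_diagBound {d m : ℕ} {V : Potential d m} (ε : ℝ) {f : L2 d m}
    (hf : ∀ i, Integrable (fun x => V.toFun x i i * f x i ^ 2) volume) :
    Integrable (fun x => diagBound (V.toFun x) ε (f x)) volume :=
  integrable_finsetSum _ fun i _ => integrable_finsetSum _ fun j _ =>
    ((hf i).add (hf j)).add ((integrable_norm_sq f).const_mul _)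

theorem mem_formDomain_of_diag {d m : ℕ} {V U : Potential d m} {ε : ℝ} (hε : 0 ≤ ε)
    (hU : ∀ᵐ x, ∀ i j, |U.toFun x i j| ≤ |V.toFun x i j| + ε) {f : L2 d m}
    (hw : ∀ k, ∃ g, IsWeakPartial k f g)
    (hf : ∀ i, Integrable (fun x => V.toFun x i i * f x i ^ 2) volume) : f ∈ formDomain U := by
  refine ⟨hw, (integrable_diagBound ε hf).mono' (aestronglyMeasurable_matPair U f f) ?_⟩
  filter_upwards [hU, V.symm, V.nonneg] with x h hs hp
  exact abs_matPair_le_diagBound hs hp hε h _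

/-- Membership for `M` yields integrable diagonal terms, a condition independent of `M` and
sufficient for every `N`. The domain of `V + ε` contains this common domain but may be larger,
through cancellation. -/
theorem formDomain_trunc_le {d m : ℕ} {V : Potential d m} {ε : ℝ} (hε : 0 < ε) (M N : ℕ) :
    formDomain (V.trunc ε hε M) ≤ formDomain (V.trunc ε hε N) := by
  intro f hf
  refine mem_formDomain_of_diag hε.le ?_ hf.1 (integrable_diag_of_mem_trunc hf)
  filter_upwards [V.offDiag] with x ho
  exact abs_truncMatrix_le hε.le N ho

theorem formDomain_trunc_le_shift {d m : ℕ} {V : Potential d m} {ε : ℝ} (hε : 0 < ε) (M : ℕ) :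
    formDomain (V.trunc ε hε M) ≤ formDomain (V.shift ε hε) := by
  intro f hf
  refine mem_formDomain_of_diag hε.le ?_ hf.1 (integrable_diag_of_mem_trunc hf)
  exact Eventually.of_forall fun x => abs_shift_le _ hε.le

theorem trunc_anti {d m : ℕ} (V : Potential d m) {ε : ℝ} (hε : 0 < ε) {M N : ℕ} (h : M ≤ N) (x)
    (i j : Fin m) : (V.trunc ε hε N).toFun x i j ≤ (V.trunc ε hε M).toFun x i j := by
  simp only [Potential.trunc, truncMatrix]
  split_ifs
  · exact le_rfl
  · exact max_le_max le_rfl (by simpa using h)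

theorem shift_le_trunc {d m : ℕ} (V : Potential d m) {ε : ℝ} (hε : 0 < ε) (M : ℕ) (x)
    (i j : Fin m) : (V.shift ε hε).toFun x i j ≤ (V.trunc ε hε M).toFun x i j := by
  simp only [Potential.trunc, Potential.shift, truncMatrix, Matrix.add_apply, Matrix.smul_apply,
    Matrix.one_apply]
  split_ifs
  · simp
  · simp

theorem tendsto_truncMatrix {m : ℕ} (A : Matrix (Fin m) (Fin m) ℝ) (ε : ℝ) (i j : Fin m) :
    Tendsto (fun M : ℕ => truncMatrix A ε M i j) atTop
      (𝓝 ((A + ε • (1 : Matrix (Fin m) (Fin m) ℝ)) i j)) := by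
  refine tendsto_const_nhds.congr' ?_
  obtain ⟨N, hN⟩ := exists_nat_ge (-(A i j))
  filter_upwards [eventually_ge_atTop N] with M hM
  have hM' : (N : ℝ) ≤ M := by exact_mod_cast hM
  rw [truncMatrix, Matrix.add_apply, Matrix.smul_apply, Matrix.one_apply]
  split_ifs
  · simp
  · rw [max_eq_left (by linarith)]; simp

/-- Each truncated entry is eventually equal to the original one, and `diagBound` dominates
uniformly in `M`. -/
theorem tendsto_form_trunc {d m : ℕ} {V : Potential d m} {ε : ℝ} (hε : 0 < ε) {f : L2 d m}
    (hf : f ∈ formDomain (V.trunc ε hε 0)) :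
    Tendsto (fun M => form (V.trunc ε hε M) f f) atTop (𝓝 (form (V.shift ε hε) f f)) := by
  simp only [fun M => form_eq (formDomain_trunc_le hε 0 M hf) (formDomain_trunc_le hε 0 M hf)]
  rw [form_eq (formDomain_trunc_le_shift hε 0 hf) (formDomain_trunc_le_shift hε 0 hf)]
  refine tendsto_const_nhds.add ?_
  refine tendsto_integral_of_dominated_convergence _
    (fun M => aestronglyMeasurable_matPair _ f f)
    (integrable_diagBound ε (integrable_diag_of_mem_trunc hf)) (fun M => ?_)
    (Eventually.of_forall fun x => ?_)
  · filter_upwards [V.symm, V.offDiag, V.nonneg] with x hs ho hp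
    exact abs_matPair_le_diagBound hs hp hε.le (abs_truncMatrix_le hε.le M ho) _
  · exact tendsto_finsetSum _ fun i _ => tendsto_finsetSum _ fun j _ =>
      ((tendsto_truncMatrix (V.toFun x) ε i j).mul_const _).mul_const _

/-! ### The operators -/

theorem bijective_of_existsUnique_graph {E F : Type*} [AddCommGroup E] [Module ℝ E]
    [AddCommGroup F] [Module ℝ F] (T : E →ₗ.[ℝ] F) (h : ∀ f, ∃! u, (u, f) ∈ T.graph) :
    Function.Bijective T := by
  refine ⟨fun u v huv => Subtype.ext ?_, fun f => ?_⟩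
  · exact (h (T u)).unique (T.mem_graph u) (huv ▸ T.mem_graph v)
  · obtain ⟨u, hu, -⟩ := h f
    obtain ⟨y, -, hy⟩ := T.mem_graph_iff.1 hu
    exact ⟨y, hy⟩

theorem invApply_eq {d m : ℕ} {T : L2 d m →ₗ.[ℝ] L2 d m} (hT : Function.Injective T)
    {u f : L2 d m} (h : (u, f) ∈ T.graph) : invApply T f = u := by
  have hk : LinearMap.ker T.toFun = ⊥ := LinearMap.ker_eq_bot.2 hT
  obtain ⟨y, rfl, rfl⟩ := T.mem_graph_iff.1 h
  have hd : T y ∈ T.inverse.domain := by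
    rw [LinearPMap.inverse_domain]
    exact ⟨y, rfl⟩
  rw [invApply, dif_pos hd]
  exact LinearPMap.inverse_apply_eq hk rfl

/-- Density of test functions lets the closure be replaced by the maximal domain. -/
theorem mem_graph_opHTrunc {d m : ℕ} (V : Potential d m) {ε : ℝ} (hε : 0 < ε) (M : ℕ)
    (u f : L2 d m) : (u, f) ∈ (opHTrunc V ε hε M).graph ↔ IsSolution (V.trunc ε hε M) f u := by
  rw [opHTrunc, formOperator_graph _ _ _ fun φ hφ => hφ.mem_formClosure _]
  change (u ∈ formClosure _ ∧ ∀ φ ∈ formClosure _, _) ↔ _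
  rw [formClosure_eq_formDomain]
  rfl

theorem mem_graph_opH {d m : ℕ} (V : Potential d m) (u f : L2 d m) :
    (u, f) ∈ (opH V).graph ↔ IsSolution V f u := by
  rw [opH, formOperator_graph _ _ _ fun φ hφ => hφ.mem_formDomain _]
  rfl

theorem mem_graph_opHShift {d m : ℕ} (V : Potential d m) {ε : ℝ} (hε : 0 < ε) (u f : L2 d m) :
    (u, f) ∈ (opHShift V ε).graph ↔ IsSolution (V.shift ε hε) f u := by
  -- `(𝓗 + ε) u = f` means `𝓗 u = f - ε u`; the term `ε ⟨u, φ⟩` then moves into the form of `V + ε`.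
  have h1 : (u, f) ∈ (opHShift V ε).graph ↔ (u, f - ε • u) ∈ (opH V).graph := by
    rw [LinearPMap.mem_graph_iff, LinearPMap.mem_graph_iff]
    refine exists_congr fun y => and_congr_right fun hy => ?_
    dsimp only at hy ⊢
    rw [← hy]
    exact eq_sub_iff_add_eq'.symm
  rw [h1, mem_graph_opH, IsSolution, IsSolution, formDomain_shift V hε]
  refine and_congr_right fun hu => forall₂_congr fun φ hφ => ?_
  rw [form_shift hε hu hφ, inner_sub_left, real_inner_smul_left, eq_sub_iff_add_eq]

theorem opHTrunc_bijective {d m : ℕ} (V : Potential d m) {ε : ℝ} (hε : 0 < ε) (M : ℕ) :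
    Function.Bijective (opHTrunc V ε hε M) := by
  refine bijective_of_existsUnique_graph _ fun f => ?_
  simp only [mem_graph_opHTrunc]
  have hW := coercive_trunc V hε M
  obtain ⟨u, hu⟩ := hW.exists_isSolution (half_pos hε) f
  exact ⟨u, hu, fun v hv => hW.isSolution_unique (half_pos hε) hv hu⟩

theorem opHShift_bijective {d m : ℕ} (V : Potential d m) {ε : ℝ} (hε : 0 < ε) :
    Function.Bijective (opHShift V ε) := by
  refine bijective_of_existsUnique_graph _ fun f => ?_
  simp only [mem_graph_opHShift V hε]
  have hW := coercive_shift V hε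
  obtain ⟨u, hu⟩ := hW.exists_isSolution hε f
  exact ⟨u, hu, fun v hv => hW.isSolution_unique hε hv hu⟩

theorem isSolution_invApply_opHTrunc {d m : ℕ} (V : Potential d m) {ε : ℝ} (hε : 0 < ε) (M : ℕ)
    (f : L2 d m) : IsSolution (V.trunc ε hε M) f (invApply (opHTrunc V ε hε M) f) := by
  obtain ⟨u, hu⟩ := (coercive_trunc V hε M).exists_isSolution (half_pos hε) f
  rwa [invApply_eq (opHTrunc_bijective V hε M).1 ((mem_graph_opHTrunc V hε M u f).2 hu)]

theorem isSolution_invApply_opHShift {d m : ℕ} (V : Potential d m) {ε : ℝ} (hε : 0 < ε)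
    (f : L2 d m) : IsSolution (V.shift ε hε) f (invApply (opHShift V ε) f) := by
  obtain ⟨u, hu⟩ := (coercive_shift V hε).exists_isSolution hε f
  rwa [invApply_eq (opHShift_bijective V hε).1 ((mem_graph_opHShift V hε u f).2 hu)]

/-! ### Convergence of the solutions -/

theorem form_sub_sub {d m : ℕ} {W : Potential d m} {f g : L2 d m} (hf : f ∈ formDomain W)
    (hg : g ∈ formDomain W) :
    form W (f - g) (f - g) = form W f f - 2 * form W g f + form W g g := by
  have hd := (formDomain W).sub_mem hf hg
  rw [form_sub_left hf hg hd, form_comm W f, form_comm W g (f - g), form_sub_left hf hg hf,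
    form_sub_left hf hg hg, form_comm W f g]
  ring

/-- The energy `a_W(v, v) - 2 ⟨f, v⟩` of `v` exceeds the energy of the solution `u` by
`a_W(v - u, v - u)`. -/
theorem IsSolution.form_sub_sub {d m : ℕ} {W : Potential d m} {f u v : L2 d m}
    (hu : IsSolution W f u) (hv : v ∈ formDomain W) :
    form W (v - u) (v - u)
      = (form W v v - 2 * inner ℝ f v) - (form W u u - 2 * inner ℝ f u) := by
  rw [VSchrodinger.form_sub_sub hv hu.1, hu.2 v hv, hu.2 u hu.1]
  ring

/-- The energy argument: sign information on `u M` gives one-sided comparison of the two energies,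
and minimality of `u M` against a fixed test function gives the other side in the limit. -/
theorem tendsto_form_sub_of_nonneg {d m : ℕ} {V : Potential d m} {ε : ℝ} (hε : 0 < ε)
    {f w : L2 d m} {u : ℕ → L2 d m} (hf : CompLE 0 f)
    (hu : ∀ M, IsSolution (V.trunc ε hε M) f (u M)) (hw : IsSolution (V.shift ε hε) f w) :
    Tendsto (fun M => form (V.shift ε hε) (u M - w) (u M - w)) atTop (𝓝 0) := by
  have hus : ∀ M, u M ∈ formDomain (V.shift ε hε) := fun M =>
    formDomain_trunc_le_shift hε M (hu M).1
  rw [Metric.tendsto_atTop]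
  intro δ hδ
  have hwc : w ∈ formClosure (V.shift ε hε) := by
    rw [formClosure_eq_formDomain]; exact hw.1
  -- A test function is needed because `w` may lie outside the domains of the truncated forms. Half
  -- of `δ` is spent on replacing `w` by `v`, half on the convergence of the forms at `v`.
  obtain ⟨v, hv, hv'⟩ := hwc.2 (Real.sqrt (δ / 2)) (Real.sqrt_pos.2 (by positivity))
  rw [formNorm, Real.sqrt_lt_sqrt_iff (form_nonneg _ _), VSchrodinger.form_sub_sub hw.1
    (hv.mem_formDomain _), form_comm _ v w] at hv'
  have hJ : form (V.shift ε hε) v v - 2 * inner ℝ f v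
      - (form (V.shift ε hε) w w - 2 * inner ℝ f w) < δ / 2 := by
    rw [← hw.form_sub_sub (hv.mem_formDomain _),
      VSchrodinger.form_sub_sub (hv.mem_formDomain _) hw.1]
    linarith
  have ht := tendsto_form_trunc hε (hv.mem_formDomain (V.trunc ε hε 0))
  obtain ⟨N, hN⟩ := Metric.tendsto_atTop.1 ht (δ / 2) (by positivity)
  refine ⟨N, fun M hM => ?_⟩
  rw [Real.dist_eq, sub_zero, abs_of_nonneg (form_nonneg _ _), hw.form_sub_sub (hus M)]
  have h0 := (hu M).nonneg (half_pos hε) (coercive_trunc V hε M) hf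
  have h1 : form (V.shift ε hε) (u M) (u M) ≤ form (V.trunc ε hε M) (u M) (u M) :=
    form_le_form_of_entrywise (Eventually.of_forall fun x => shift_le_trunc V hε M x) (hu M).1
      (hus M) (hu M).1 (hus M) h0 h0
  -- Nonnegativity of `a_{ε,M}(v - u_M, v - u_M)` is minimality of `u M` for the truncated energy.
  have h2 := form_nonneg (V.trunc ε hε M) (v - u M)
  rw [(hu M).form_sub_sub (hv.mem_formDomain _)] at h2
  have h3 := (abs_lt.1 (hN M hM)).2
  linarith

theorem posPart_sub_posPart_neg {d m : ℕ} (f : L2 d m) : posPart f - posPart (-f) = f := by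
  refine Lp.ext ?_
  filter_upwards [Lp.coeFn_sub (posPart f) (posPart (-f)), coeFn_posPart f, coeFn_posPart (-f),
    Lp.coeFn_neg f] with x h1 h2 h3 h4
  ext i
  rw [h1, Pi.sub_apply, PiLp.sub_apply, h2, h3, h4, Pi.neg_apply, PiLp.neg_apply]
  rcases le_total (f x i) 0 with h | h
  · rw [max_eq_right h, max_eq_left (by linarith)]; ring
  · rw [max_eq_left h, max_eq_right (by linarith)]; ring

/-- Solutions depend linearly on `f`, so `f = f⁺ - f⁻` reduces the claim to nonnegative data. -/
theorem tendsto_formNorm_sub {d m : ℕ} {V : Potential d m} {ε : ℝ} (hε : 0 < ε)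
    {f w : L2 d m} {u : ℕ → L2 d m}
    (hu : ∀ M, IsSolution (V.trunc ε hε M) f (u M)) (hw : IsSolution (V.shift ε hε) f w) :
    Tendsto (fun M => formNorm (V.shift ε hε) (u M - w)) atTop (𝓝 0) := by
  have hT := fun (g : L2 d m) (M : ℕ) =>
    (coercive_trunc V hε M).exists_isSolution (half_pos hε) g
  choose S hS using hT
  choose R hR using (coercive_shift V hε).exists_isSolution hε
  have hdom : ∀ g M, S g M - R g ∈ formDomain (V.shift ε hε) := fun g M =>
    (formDomain _).sub_mem (formDomain_trunc_le_shift hε M (hS g M).1) (hR g).1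
  have e : ∀ M, u M - w
      = (S (posPart f) M - R (posPart f)) + (-1 : ℝ) • (S (posPart (-f)) M - R (posPart (-f))) := by
    intro M
    have h1 := (hS (posPart f) M).sub (hS (posPart (-f)) M)
    have h2 := (hR (posPart f)).sub (hR (posPart (-f)))
    rw [posPart_sub_posPart_neg] at h1 h2
    rw [(coercive_trunc V hε M).isSolution_unique (half_pos hε) (hu M) h1,
      (coercive_shift V hε).isSolution_unique hε hw h2, neg_one_smul]
    abel
  have hF : Tendsto (fun M => form (V.shift ε hε) (u M - w) (u M - w)) atTop (𝓝 0) := by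
    have t1 := tendsto_form_sub_of_nonneg hε (compLE_zero_posPart f) (hS _) (hR _)
    have t2 := tendsto_form_sub_of_nonneg hε (compLE_zero_posPart (-f)) (hS _) (hR _)
    have t3 := (t1.const_mul 2).add (t2.const_mul 2)
    rw [mul_zero, add_zero] at t3
    refine squeeze_zero (fun M => form_nonneg _ _) (fun M => ?_) t3
    rw [e]
    refine (form_add_self_le _ (hdom _ M) ((formDomain _).smul_mem _ (hdom _ M))).trans ?_
    rw [form_smul_left _ _ (hdom _ M), form_comm _ _ ((-1 : ℝ) • _), form_smul_left _ _ (hdom _ M)]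
    linarith
  have := (Real.continuous_sqrt.tendsto 0).comp hF
  rwa [Real.sqrt_zero] at this

end VSchrodinger

theorem mainTheorem9 (d m : ℕ) (V : VSchrodinger.Potential d m) (ε : ℝ) (hε : 0 < ε) :
    -- the operators `𝓗_{ε,M}` and `𝓗 + ε` are invertible
    (∀ M : ℕ, Function.Bijective (VSchrodinger.opHTrunc V ε hε M)) ∧
    Function.Bijective (VSchrodinger.opHShift V ε) ∧
    ∀ f : VSchrodinger.L2 d m, VSchrodinger.CompactlySupported f →
      -- convergence in `𝓥_ε`
      ((∀ M : ℕ, VSchrodinger.invApply (VSchrodinger.opHTrunc V ε hε M) f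
          ∈ VSchrodinger.formClosure (V.shift ε hε)) ∧
        VSchrodinger.invApply (VSchrodinger.opHShift V ε) f
          ∈ VSchrodinger.formClosure (V.shift ε hε) ∧
        Tendsto (fun M : ℕ => VSchrodinger.formNorm (V.shift ε hε)
            (VSchrodinger.invApply (VSchrodinger.opHTrunc V ε hε M) f
              - VSchrodinger.invApply (VSchrodinger.opHShift V ε) f)) atTop (𝓝 0)) ∧
      -- positivity and monotonicity
      (VSchrodinger.CompLE 0 f →
        (∀ M : ℕ, VSchrodinger.CompLE 0
          (VSchrodinger.invApply (VSchrodinger.opHTrunc V ε hε M) f)) ∧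
        VSchrodinger.CompLE 0 (VSchrodinger.invApply (VSchrodinger.opHShift V ε) f) ∧
        ∀ M₁ M₂ : ℕ, M₁ ≤ M₂ → VSchrodinger.CompLE
          (VSchrodinger.invApply (VSchrodinger.opHTrunc V ε hε M₁) f)
          (VSchrodinger.invApply (VSchrodinger.opHTrunc V ε hε M₂) f)) := by
  refine ⟨VSchrodinger.opHTrunc_bijective V hε, VSchrodinger.opHShift_bijective V hε, fun f _ => ?_⟩
  have hu := fun M => VSchrodinger.isSolution_invApply_opHTrunc V hε M f
  have hw := VSchrodinger.isSolution_invApply_opHShift V hε f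
  -- With `𝓥_ε` identified as a maximal domain, membership of the truncated solutions is the
  -- inclusion of form domains.
  rw [VSchrodinger.formClosure_eq_formDomain]
  refine ⟨⟨fun M => VSchrodinger.formDomain_trunc_le_shift hε M (hu M).1, hw.1,
    VSchrodinger.tendsto_formNorm_sub hε hu hw⟩, fun hf => ⟨fun M => ?_, ?_, fun M N hMN => ?_⟩⟩
  · exact (hu M).nonneg (half_pos hε) (VSchrodinger.coercive_trunc V hε M) hf
  · exact hw.nonneg hε (VSchrodinger.coercive_shift V hε) hf
  · exact (hu M).compLE (half_pos hε) (VSchrodinger.coercive_trunc V hε M) (half_pos hε)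
      (VSchrodinger.coercive_trunc V hε N)
      (Eventually.of_forall fun x => VSchrodinger.trunc_anti V hε hMN x)
      (le_antisymm (VSchrodinger.formDomain_trunc_le hε M N)
        (VSchrodinger.formDomain_trunc_le hε N M)) hf (hu N)
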